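/- Let $C$ be a smooth projective (connected) curve over $\mathbb C$, let $L$ be a line bundle and $F$ a vector bundle of rank $n$ on $C$. Let $W$ be a vector bundle of rank $2n$ on $C$ with an $L$-valued symplectic form $\omega$ (alternating and nondegenerate), and let $i\colon F\hookrightarrow W$ be a Lagrangian subbundle (an isotropic subbundle of rank $n$). Let $$0\to F\xrightarrow{\,i\,} W\xrightarrow{\,\pi\,} F^*\otimes L\to 0,\qquad \pi(w)=\omega(w,i(\cdot)),$$ be the induced symplectic extension. For a vector bundle $V$ on $C$ write $H^1(C,V)$ as the cokernel of $\mathrm{Rat}(V)\to\mathrm{Prin}(V)$, where $\mathrm{Rat}(V)$ is the space of rational sections and $\mathrm{Prin}(V)$ the space of principal parts of $V$. Regard $L^{-1}\otimes\mathrm{Sym}^2F$ as the sheaf of symmetric sections of $L^{-1}\otimes F\otimes F=\mathcal Hom(F^*\otimes L,F)$. For a closed point $x\in C$ and a line $\eta\subset F|_x$ (that is, a point $\eta$ of $\mathbb PF$ over $x$), let $v_\eta\in H^1(C,L^{-1}\otimes\mathrm{Sym}^2F)$ be the class of the principal part $\frac{\lambda\otimes s\otimes s}{z}$ supported at $x$,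 where $\lambda$ is a local generator of $L^{-1}$, $z$ is a uniformizer at $x$, and $s$ is a local section of $F$ whose value at $x$ spans $\eta$; up to nonzero scalars $v_\eta$ depends only on $\eta$. The rational map $\psi\colon\mathbb PF\dashrightarrow\mathbb PH^1(C,L^{-1}\otimes\mathrm{Sym}^2F)$ is defined at $\eta$ if $v_\eta\neq0$, and then $\psi(\eta)=[v_\eta]$. Let $\eta_1,\dots,\eta_t$ ($t\ge 0$) be points of $\mathbb PF$ lying over distinct closed points $x_1,\dots,x_t$ of $C$, and let $\gamma\colon E\hookrightarrow F^*\otimes L$ be the elementary transformation with reduced support that they define: $E$ is the subsheaf of sections of $F^*\otimes L$ taking values in $\mathrm{Ker}(\eta_k)$ at $x_k$ for every $k$. Then there is a unique class $\delta(W)\in H^1(C,L^{-1}\otimes\mathrm{Sym}^2F)$ whose image in $H^1(C,\mathcal Hom(F^*\otimes L,F))$ is the class of the extension above, and the following are equivalent: (i) $E$ lifts to a Lagrangian subsheaf of $W$, that is, there is an injective morphism $j\colon E\to W$ with $\pi\circ j=\gamma$ whose image is an isotropic subsheaf of rank $n$; (ii) $\delta(W)$ lies in the cone (linear subspace of $H^1(C,L^{-1}\otimes\mathrm{Sym}^2F)$)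 over the projective linear span of those points among $\psi(\eta_1),\dots,\psi(\eta_t)$ that are defined; the cone over the empty span is $\{0\}$. -/

import Mathlib

open CategoryTheory AlgebraicGeometry TopologicalSpace Opposite
open scoped LinearAlgebra.Projectivization

noncomputable section

namespace LagLift

variable {X : Scheme.{0}}

/-- Restriction of sections of an `O_X`-module. -/
def res (M : X.Modules) {U V : X.Opens} (h : V ≤ U) : Γ(M, U) →+ Γ(M, V) :=
  (M.presheaf.map (homOfLE h).op).hom

/-- Restriction of functions. -/
def resO (X : Scheme.{0}) {U V : X.Opens} (h : V ≤ U) : Γ(X, U) →+* Γ(X, V) :=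
  (X.presheaf.map (homOfLE h).op).hom

lemma res_smul (M : X.Modules) {U V : X.Opens} (h : V ≤ U) (r : Γ(X, U)) (m : Γ(M, U)) :
    res M h (r • m) = resO X h r • res M h m :=
  Scheme.Modules.map_smul M (homOfLE h) r m

lemma res_self (M : X.Modules) {U : X.Opens} (h : U ≤ U) (m : Γ(M, U)) : res M h m = m := by
  simp [res]

lemma res_res (M : X.Modules) {U V T : X.Opens} (h : V ≤ U) (h' : T ≤ V) (m : Γ(M, U)) :
    res M h' (res M h m) = res M (h'.trans h) m := by
  have : (homOfLE (h'.trans h)).op = (homOfLE h).op ≫ (homOfLE h').op := rfl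
  simp [res, this]

lemma resO_resO {U V T : X.Opens} (h : V ≤ U) (h' : T ≤ V) (r : Γ(X, U)) :
    resO X h' (resO X h r) = resO X (h'.trans h) r := by
  have : (homOfLE (h'.trans h)).op = (homOfLE h).op ≫ (homOfLE h').op := rfl
  simp [resO, this]

lemma resO_self {U : X.Opens} (h : U ≤ U) (r : Γ(X, U)) : resO X h r = r := by
  simp [resO]

lemma app_res {M N : X.Modules} (f : M ⟶ N) {U V : X.Opens} (h : V ≤ U) (m : Γ(M, U)) :
    f.app V (res M h m) = res N h (f.app U m) :=
  PresheafOfModules.naturality_apply f.val (homOfLE h).op m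

lemma eq_of_local (M : X.Modules) {U : X.Opens} {s t : Γ(M, U)}
    (H : ∀ x ∈ U, ∃ (V : X.Opens) (h : V ≤ U), x ∈ V ∧ res M h s = res M h t) : s = t := by
  choose V hV hx h using H
  refine TopCat.Sheaf.eq_of_locally_eq' (⟨M.presheaf, M.isSheaf⟩ : TopCat.Sheaf Ab X)
    (fun x : U ↦ V x.1 x.2) U (fun x ↦ homOfLE (hV x.1 x.2)) ?_ s t ?_
  · intro x hxU
    exact Opens.mem_iSup.2 ⟨(⟨x, hxU⟩ : U), hx x hxU⟩
  · intro x
    exact h x.1 x.2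

lemma exists_glue (M : X.Modules) {ι : Type} (V : ι → X.Opens) (U : X.Opens)
    (hV : ∀ i, V i ≤ U) (hU : U ≤ iSup V) (s : ∀ i, Γ(M, V i))
    (hs : ∀ i j, res M (inf_le_left : V i ⊓ V j ≤ V i) (s i) =
      res M (inf_le_right : V i ⊓ V j ≤ V j) (s j)) :
    ∃ t : Γ(M, U), ∀ i, res M (hV i) t = s i := by
  have h := TopCat.Sheaf.existsUnique_gluing'
    (⟨M.presheaf, M.isSheaf⟩ : TopCat.Sheaf Ab X) V U (fun i ↦ homOfLE (hV i)) hU s hs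
  exact h.exists

/-- A section over `U` of the sheaf `Hom(M, N)`. -/
@[ext]
structure HomSec (M N : X.Modules) (U : X.Opens) where
  app : ∀ V : X.Opens, V ≤ U → (Γ(M, V) →ₗ[Γ(X, V)] Γ(N, V))
  app_res : ∀ (V T : X.Opens) (hV : V ≤ U) (hT : T ≤ V) (m : Γ(M, V)),
    app T (hT.trans hV) (res M hT m) = res N hT (app V hV m)

namespace HomSec
variable {M N : X.Modules} {U : X.Opens}

instance : Zero (HomSec M N U) := ⟨⟨fun _ _ ↦ 0, by simp⟩⟩
instance : Add (HomSec M N U) :=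
  ⟨fun a b ↦ ⟨fun V h ↦ a.app V h + b.app V h, by intro V T hV hT m; simp [a.app_res V T hV hT, b.app_res V T hV hT]⟩⟩
instance : Neg (HomSec M N U) :=
  ⟨fun a ↦ ⟨fun V h ↦ - a.app V h, by intro V T hV hT m; simp [a.app_res V T hV hT]⟩⟩
instance : SMul Γ(X, U) (HomSec M N U) :=
  ⟨fun r a ↦ ⟨fun V h ↦ resO X h r • a.app V h, by
    intro V T hV hT m; simp [a.app_res V T hV hT, res_smul, resO_resO]⟩⟩

lemma add_app (a b : HomSec M N U) (V : X.Opens) (h : V ≤ U) :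
    (a + b).app V h = a.app V h + b.app V h := rfl
lemma zero_app (V : X.Opens) (h : V ≤ U) : (0 : HomSec M N U).app V h = 0 := rfl
lemma neg_app (a : HomSec M N U) (V : X.Opens) (h : V ≤ U) :
    (-a).app V h = - a.app V h := rfl
lemma smul_app (r : Γ(X, U)) (a : HomSec M N U) (V : X.Opens) (h : V ≤ U) :
    (r • a).app V h = resO X h r • a.app V h := rfl

instance : AddCommGroup (HomSec M N U) where
  add_assoc a b c := by ext; simp [add_app, add_assoc]
  zero_add a := by ext; simp [add_app, zero_app]
  add_zero a := by ext; simp [add_app, zero_app]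
  add_comm a b := by ext; simp [add_app, add_comm]
  neg_add_cancel a := by ext; simp [add_app, neg_app, zero_app]
  nsmul := nsmulRec
  zsmul := zsmulRec

instance : Module Γ(X, U) (HomSec M N U) where
  one_smul a := by ext; simp [smul_app]
  mul_smul r s a := by ext; simp [smul_app, mul_smul]
  smul_zero r := by ext; simp [smul_app, zero_app]
  smul_add r a b := by ext; simp [smul_app, add_app]
  add_smul r s a := by ext; simp [smul_app, add_app, add_smul]
  zero_smul a := by ext; simp [smul_app, zero_app]

/-- Restriction of a section of `Hom(M, N)`. -/
def restrict {V : X.Opens} (h : V ≤ U) : HomSec M N U →+ HomSec M N V where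
  toFun a := ⟨fun T hT ↦ a.app T (hT.trans h), fun V T hV hT m ↦ a.app_res V T (hV.trans h) hT m⟩
  map_zero' := rfl
  map_add' _ _ := rfl

end HomSec

instance (M N : X.Modules) (U : X.Opensᵒᵖ) :
  Module (X.ringCatSheaf.obj.obj U) (HomSec M N U.unop) :=
  inferInstanceAs (Module Γ(X, U.unop) (HomSec M N U.unop))

/-- The presheaf of abelian groups underlying `Hom(M, N)`. -/
def homPresheaf (M N : X.Modules) : X.Opensᵒᵖ ⥤ Ab where
  obj U := AddCommGrpCat.of (HomSec M N U.unop)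
  map f := AddCommGrpCat.ofHom (HomSec.restrict f.unop.le)

instance (M N : X.Modules) (U : X.Opensᵒᵖ) :
  Module (X.ringCatSheaf.obj.obj U) ((homPresheaf M N).obj U) :=
  inferInstanceAs (Module Γ(X, U.unop) (HomSec M N U.unop))

lemma homPresheaf_isSheaf (M N : X.Modules) :
    TopCat.Presheaf.IsSheaf (homPresheaf M N : TopCat.Presheaf Ab X) := by
  rw [TopCat.Presheaf.isSheaf_iff_isSheafUniqueGluing]
  intro ι U sf hsf
  change ∀ i, HomSec M N (U i) at sf
  have hsf' : ∀ i j V (hi : V ≤ U i) (hj : V ≤ U j), (sf i).app V hi = (sf j).app V hj :=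
    fun i j V hi hj ↦
      congr_arg (fun a : HomSec M N (U i ⊓ U j) ↦ a.app V (le_inf hi hj)) (hsf i j)
  have key : ∀ (V : X.Opens) (_ : V ≤ iSup U) (m : Γ(M, V)), ∃ n : Γ(N, V),
      ∀ i, res N (inf_le_left : V ⊓ U i ≤ V) n =
        (sf i).app (V ⊓ U i) inf_le_right (res M inf_le_left m) := by
    intro V hV m
    refine exists_glue N (fun i ↦ V ⊓ U i) V (fun i ↦ inf_le_left) ?_ _ ?_
    · rw [← inf_iSup_eq]; exact le_inf le_rfl hV
    · intro i j
      rw [← HomSec.app_res, ← HomSec.app_res, res_res, res_res,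
        hsf' i j _ (inf_le_left.trans inf_le_right) (inf_le_right.trans inf_le_right)]
  have uniq : ∀ (V : X.Opens) (_ : V ≤ iSup U) (n n' : Γ(N, V)),
      (∀ i, res N (inf_le_left : V ⊓ U i ≤ V) n = res N inf_le_left n') → n = n' := by
    intro V hV n n' h
    refine eq_of_local N fun x hx ↦ ?_
    obtain ⟨i, hi⟩ := Opens.mem_iSup.1 (hV hx)
    exact ⟨V ⊓ U i, inf_le_left, ⟨hx, hi⟩, h i⟩
  choose g hg using key
  let t : HomSec M N (iSup U) :=
    { app := fun V hV ↦
        { toFun := g V hV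
          map_add' := fun a b ↦ uniq V hV _ _ fun i ↦ by simp [hg]
          map_smul' := fun r a ↦ uniq V hV _ _ fun i ↦ by simp [hg, res_smul] }
      app_res := fun V T hV hT m ↦ uniq T (hT.trans hV) _ _ fun i ↦ by
        have e : res N (inf_le_left : T ⊓ U i ≤ T) (res N hT (g V hV m)) =
            res N (inf_le_inf_right (U i) hT) (res N inf_le_left (g V hV m)) := by
          rw [res_res, res_res]
        change res N inf_le_left (g T _ (res M hT m)) =
          res N inf_le_left (res N hT (g V hV m))
        rw [e, hg, hg, ← HomSec.app_res, res_res, res_res] }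
  refine ⟨t, fun i ↦ ?_, fun t' ht' ↦ ?_⟩
  · change HomSec.restrict (le_iSup U i) t = sf i
    ext V hV m
    refine uniq V (hV.trans (le_iSup U i)) _ _ fun j ↦ ?_
    change res N inf_le_left (g V _ m) = _
    rw [hg, ← HomSec.app_res, hsf' j i _ inf_le_right (inf_le_left.trans hV)]
  · change HomSec M N (iSup U) at t'
    refine HomSec.ext (funext fun V ↦ funext fun hV ↦ LinearMap.ext fun m ↦ ?_)
    refine uniq V hV _ _ fun j ↦ ?_
    change _ = res N inf_le_left (g V _ m)
    rw [hg, ← HomSec.app_res]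
    have := congr_arg (fun a : HomSec M N (U j) ↦ a.app (V ⊓ U j) inf_le_right) (ht' j)
    exact congr($this (res M inf_le_left m))


lemma homPresheaf_map_smul (M N : X.Modules) {U V : X.Opensᵒᵖ} (f : U ⟶ V) (r : Γ(X, U.unop))
    (m : HomSec M N U.unop) :
    HomSec.restrict f.unop.le (r • m) =
      resO X f.unop.le r • HomSec.restrict f.unop.le m := by
  ext T hT a
  exact congr_arg (· • m.app T (hT.trans f.unop.le) a) (resO_resO f.unop.le hT r).symm

/-- The sheaf `Hom(M, N)` of `O_X`-linear maps; its sections over `U` are `HomSec M N U`. -/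
def sheafHom (M N : X.Modules) : X.Modules where
  val := PresheafOfModules.ofPresheaf (homPresheaf M N)
    fun _ _ f r m ↦ homPresheaf_map_smul M N f r m
  isSheaf := homPresheaf_isSheaf M N

/-- A morphism of `O_X`-modules from a compatible family of linear maps on sections. -/
def mkHom {M N : X.Modules} (f : ∀ U : X.Opens, Γ(M, U) →ₗ[Γ(X, U)] Γ(N, U))
    (hf : ∀ (U V : X.Opens) (h : V ≤ U) (m : Γ(M, U)), f V (res M h m) = res N h (f U m)) :
    M ⟶ N where
  val := PresheafOfModules.homMk
    { app := fun U ↦ AddCommGrpCat.ofHom (f U.unop).toAddMonoidHom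
      naturality := fun U V i ↦ by
        ext m
        exact hf U.unop V.unop i.unop.le m }
    fun U r m ↦ (f U.unop).map_smul r m

/-- Composition with `f : N ⟶ N'`, as a morphism `Hom(M, N) ⟶ Hom(M, N')`. -/
def postcomp (M : X.Modules) {N N' : X.Modules} (f : N ⟶ N') :
    sheafHom M N ⟶ sheafHom M N' :=
  mkHom (fun U ↦
    { toFun := fun a : HomSec M N U ↦ (
        { app := fun V hV ↦
            { toFun := fun m ↦ f.app V (a.app V hV m)
              map_add' := by simp
              map_smul' := by simp }
          app_res := fun V T hV hT m ↦ by
            have := a.app_res V T hV hT m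
            simp only [LinearMap.coe_mk, AddHom.coe_mk, this, app_res] } : HomSec M N' U)
      map_add' := fun a b ↦ HomSec.ext (funext fun V ↦ funext fun hV ↦ LinearMap.ext fun m ↦
        map_add (f.app V).hom _ _)
      map_smul' := fun r a ↦ HomSec.ext (funext fun V ↦ funext fun hV ↦ LinearMap.ext fun m ↦
        Scheme.Modules.Hom.app_smul f _ _) })
    fun U V h m ↦ rfl

/-- Composition with `f : M ⟶ M'`, as a morphism `Hom(M', N) ⟶ Hom(M, N)`. -/
def precomp {M M' : X.Modules} (f : M ⟶ M') (N : X.Modules) :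
    sheafHom M' N ⟶ sheafHom M N :=
  mkHom (fun U ↦
    { toFun := fun a : HomSec M' N U ↦ (
        { app := fun V hV ↦
            { toFun := fun m ↦ a.app V hV (f.app V m)
              map_add' := by simp
              map_smul' := by simp }
          app_res := fun V T hV hT m ↦ by
            have := a.app_res V T hV hT (f.app V m)
            simp only [LinearMap.coe_mk, AddHom.coe_mk, ← this, app_res] } : HomSec M N U)
      map_add' := fun a b ↦ rfl
      map_smul' := fun r a ↦ rfl })
    fun U V h m ↦ rfl

/-- The identity, as a global section of `Hom(M, M)`. -/
def idSec (M : X.Modules) : Γ(sheafHom M M, ⊤) :=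
  (⟨fun _ _ ↦ LinearMap.id, fun _ _ _ _ _ ↦ rfl⟩ : HomSec M M ⊤)

/-- A family of submodules of sections, stable under restriction and of local nature, as an
`O_X`-module. -/
def subsheaf (M : X.Modules) (N : PresheafOfModules.Submodule M.val)
    (hN : ∀ (U : X.Opens) (s : Γ(M, U)),
      (∀ x ∈ U, ∃ (V : X.Opens) (h : V ≤ U), x ∈ V ∧ res M h s ∈ N.obj (op V)) →
      s ∈ N.obj (op U)) : X.Modules where
  val := N.toPresheafOfModules
  isSheaf := by
    change TopCat.Presheaf.IsSheaf (N.toPresheafOfModules.presheaf : TopCat.Presheaf Ab X)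
    rw [TopCat.Presheaf.isSheaf_iff_isSheafUniqueGluing]
    intro ι U sf hsf
    change ∀ i, N.obj (op (U i)) at sf
    obtain ⟨t, ht⟩ := exists_glue M U (iSup U) (le_iSup U) le_rfl (fun i ↦ (sf i).1)
      fun i j ↦ congr_arg Subtype.val (hsf i j)
    have htN : t ∈ N.obj (op (iSup U)) := hN _ t fun x hx ↦ by
      obtain ⟨i, hi⟩ := Opens.mem_iSup.1 hx
      refine ⟨U i, le_iSup U i, hi, ?_⟩
      rw [ht i]
      exact (sf i).2
    refine ⟨(⟨t, htN⟩ : N.obj (op (iSup U))), fun i ↦ Subtype.ext (ht i), fun t' ht' ↦ ?_⟩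
    change N.obj (op (iSup U)) at t'
    refine Subtype.ext (eq_of_local M fun x hx ↦ ?_)
    obtain ⟨i, hi⟩ := Opens.mem_iSup.1 hx
    exact ⟨U i, le_iSup U i, hi, (congr_arg Subtype.val (ht' i)).trans (ht i).symm⟩

/-- The inclusion of a subsheaf. -/
def subsheafι (M : X.Modules) (N : PresheafOfModules.Submodule M.val) (hN) :
    subsheaf M N hN ⟶ M where
  val := N.ι

/-- A section `α : Hom(F, L) → F` of `Hom(Hom(F, L), F) = L⁻¹ ⊗ F ⊗ F` is symmetric if
`⟨α φ, ψ⟩ = ⟨α ψ, φ⟩` for all local sections `φ, ψ` of `Hom(F, L) = F* ⊗ L`. -/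
def IsSymm {F L : X.Modules} {U : X.Opens} (α : HomSec (sheafHom F L) F U) : Prop :=
  ∀ (V : X.Opens) (hV : V ≤ U) (φ ψ : HomSec F L V),
    ψ.app V le_rfl (α.app V hV φ) = φ.app V le_rfl (α.app V hV ψ)

/-- The symmetric sections of `L⁻¹ ⊗ F ⊗ F = Hom(Hom(F, L), F)`. -/
def symSub (F L : X.Modules) : PresheafOfModules.Submodule (sheafHom (sheafHom F L) F).val where
  obj U :=
    { carrier := {α : HomSec (sheafHom F L) F U.unop | IsSymm α}
      zero_mem' := fun V hV φ ψ ↦ (map_zero (ψ.app V le_rfl)).trans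
        (map_zero (φ.app V le_rfl)).symm
      add_mem' := fun {a b} ha hb V hV φ ψ ↦
        (map_add (ψ.app V le_rfl) _ _).trans
          ((congr_arg₂ (· + ·) (ha V hV φ ψ) (hb V hV φ ψ)).trans
            (map_add (φ.app V le_rfl) _ _).symm)
      smul_mem' := fun r a ha V hV φ ψ ↦
        ((ψ.app V le_rfl).map_smul _ _).trans
          ((congr_arg (resO X hV (show Γ(X, U.unop) from r) • ·) (ha V hV φ ψ)).trans
            ((φ.app V le_rfl).map_smul _ _).symm) }
  map f α hα V hV φ ψ := hα V (hV.trans f.unop.le) φ ψ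

lemma symSub_local (F L : X.Modules) (U : X.Opens) (s : Γ(sheafHom (sheafHom F L) F, U))
    (h : ∀ x ∈ U, ∃ (V : X.Opens) (h : V ≤ U), x ∈ V ∧
      res (sheafHom (sheafHom F L) F) h s ∈ (symSub F L).obj (op V)) :
    s ∈ (symSub F L).obj (op U) := by
  change HomSec (sheafHom F L) F U at s
  intro V hV φ ψ
  refine eq_of_local L fun x hx ↦ ?_
  obtain ⟨T, hT, hxT, hs⟩ := h x (hV hx)
  refine ⟨V ⊓ T, inf_le_left, ⟨hx, hxT⟩, ?_⟩
  have := hs (V ⊓ T) inf_le_right (HomSec.restrict inf_le_left φ) (HomSec.restrict inf_le_left ψ)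
  have key : ∀ φ ψ : HomSec F L V, res L (inf_le_left : V ⊓ T ≤ V)
      (ψ.app V le_rfl (s.app V hV φ)) = ψ.app (V ⊓ T) inf_le_left
        (s.app (V ⊓ T) (inf_le_left.trans hV) (HomSec.restrict inf_le_left φ)) := fun φ ψ ↦
    ((ψ.app_res V _ le_rfl inf_le_left _).symm).trans
      (congr_arg (ψ.app (V ⊓ T) inf_le_left) (s.app_res V _ hV inf_le_left φ).symm)
  exact (key φ ψ).trans (this.trans (key ψ φ).symm)

/-- The sheaf `L⁻¹ ⊗ Sym² F`, as the sheaf of symmetric sections of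
`L⁻¹ ⊗ F ⊗ F = Hom(F* ⊗ L, F)`. -/
def symHom (F L : X.Modules) : X.Modules :=
  subsheaf (sheafHom (sheafHom F L) F) (symSub F L) (symSub_local F L)

/-- The inclusion of `L⁻¹ ⊗ Sym² F` in `L⁻¹ ⊗ F ⊗ F = Hom(F* ⊗ L, F)`. -/
def symHomι (F L : X.Modules) : symHom F L ⟶ sheafHom (sheafHom F L) F :=
  subsheafι _ _ _

/-! ### Vector bundles, stalks and fibres -/

/-- `e` is a frame of `M` over `U`: it freely generates `M` over every open subset of `U`. -/
def IsFrame {M : X.Modules} {U : X.Opens} {n : ℕ} (e : Fin n → Γ(M, U)) : Prop :=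
  ∀ (V : X.Opens) (h : V ≤ U),
    Function.Bijective fun c : Fin n → Γ(X, V) ↦ ∑ i, c i • res M h (e i)

/-- `M` is a vector bundle (locally free sheaf) of rank `n`. -/
def IsVectorBundle (M : X.Modules) (n : ℕ) : Prop :=
  ∀ x : X, ∃ U : X.Opens, x ∈ U ∧ ∃ e : Fin n → Γ(M, U), IsFrame e

/-- The structure sheaf as a module. -/
def structureModule (X : Scheme.{0}) : X.Modules := SheafOfModules.unit X.ringCatSheaf

/-- The stalk of an `O_X`-module, as a module over the local ring. -/
instance stalkModule (M : X.Modules) (x : X) : Module (X.presheaf.stalk x) (M.presheaf.stalk x) :=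
  let P : PresheafOfModules (X.presheaf ⋙ forget₂ CommRingCat RingCat) := M.val
  inferInstanceAs (Module (TopCat.Presheaf.stalk (C := CommRingCat) X.presheaf x)
    (TopCat.Presheaf.stalk (C := Ab) P.presheaf x))

lemma germ_smul (M : X.Modules) (x : X) (U : X.Opens) (hx : x ∈ U) (r : Γ(X, U)) (m : Γ(M, U)) :
    M.presheaf.germ U x hx (r • m) = X.presheaf.germ U x hx r • M.presheaf.germ U x hx m :=
  let P : PresheafOfModules (X.presheaf ⋙ forget₂ CommRingCat RingCat) := M.val
  PresheafOfModules.germ_smul P x U hx r m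

lemma germ_res (M : X.Modules) {x : X} {U V : X.Opens} (h : V ≤ U) (hx : x ∈ V) (m : Γ(M, U)) :
    M.presheaf.germ V x hx (res M h m) = M.presheaf.germ U x (h hx) m :=
  TopCat.Presheaf.germ_res_apply M.presheaf (homOfLE h) x hx m

/-- The base `Spec ℂ`. -/
abbrev SpecC : Scheme.{0} := Spec (CommRingCat.of ℂ)

/-- A smooth projective (connected) curve over `ℂ`: an integral scheme, proper over `ℂ`, whose
local rings at closed points are discrete valuation rings. -/
class IsSmoothProjectiveCurve (C : Scheme.{0}) [C.Over SpecC] : Prop where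
  isIntegral : IsIntegral C
  isProper : IsProper (C ↘ SpecC)
  isDVR : ∀ x : C, IsClosed {x} → IsDiscreteValuationRing (C.presheaf.stalk x)

instance (C : Scheme.{0}) [C.Over SpecC] [h : IsSmoothProjectiveCurve C] : IsIntegral C :=
  h.isIntegral

/-- Complex constants as global functions. -/
def constO (X : Scheme.{0}) [X.Over SpecC] : ℂ →+* Γ(X, ⊤) :=
  ((Scheme.ΓSpecIso (CommRingCat.of ℂ)).inv ≫ (X ↘ SpecC).appTop).hom

/-- Complex constants as germs of functions. -/
def constStalk (X : Scheme.{0}) [X.Over SpecC] (x : X) : ℂ →+* X.presheaf.stalk x :=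
  (X.presheaf.germ ⊤ x trivial).hom.comp (constO X)

/-- The fibre `M|_x = M_x / m_x M_x`. -/
def Fiber (M : X.Modules) (x : X) : Type :=
  (M.presheaf.stalk x : Type) ⧸
    (IsLocalRing.maximalIdeal (X.presheaf.stalk x) •
      (⊤ : Submodule (X.presheaf.stalk x) (M.presheaf.stalk x)))

instance (M : X.Modules) (x : X) : AddCommGroup (Fiber M x) := by
  unfold Fiber; infer_instance

instance (M : X.Modules) (x : X) : Module (X.presheaf.stalk x) (Fiber M x) := by
  unfold Fiber; infer_instance

instance [X.Over SpecC] (M : X.Modules) (x : X) : Module ℂ (Fiber M x) :=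
  Module.compHom _ (constStalk X x)

/-- The value at `x` of a section defined near `x`. -/
def value (M : X.Modules) {x : X} {U : X.Opens} (hx : x ∈ U) (s : Γ(M, U)) : Fiber M x :=
  Submodule.Quotient.mk (M.presheaf.germ U x hx s)

/-! ### Rational sections, principal parts and `H¹` -/

section H1

variable [IsIntegral X]

/-- The vector space over the function field of rational sections of `M`. -/
def Rat (M : X.Modules) : Type := M.presheaf.stalk (genericPoint X)

instance (M : X.Modules) : AddCommGroup (Rat M) :=
  inferInstanceAs (AddCommGroup (M.presheaf.stalk (genericPoint X)))

instance (M : X.Modules) : Module X.functionField (Rat M) :=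
  inferInstanceAs (Module (X.presheaf.stalk (genericPoint X))
    (M.presheaf.stalk (genericPoint X)))

instance [X.Over SpecC] (M : X.Modules) : Module ℂ (Rat M) :=
  Module.compHom _ (constStalk X (genericPoint X))

lemma generic_mem {x : X} {U : X.Opens} (hx : x ∈ U) : genericPoint X ∈ U :=
  (genericPoint_specializes x).mem_open U.isOpen hx

/-- The rational section defined by a section over an open set containing a point `x`. -/
def toRat (M : X.Modules) {x : X} {U : X.Opens} (hx : x ∈ U) (s : Γ(M, U)) : Rat M :=
  M.presheaf.germ U (genericPoint X) (generic_mem hx) s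

lemma exists_toRat (M : X.Modules) (r : Rat M) :
    ∃ (U : X.Opens) (hx : genericPoint X ∈ U) (s : Γ(M, U)), toRat M hx s = r :=
  TopCat.Presheaf.exists_germ_eq M.presheaf r

lemma toRat_res (M : X.Modules) {x y : X} {U V : X.Opens} (h : V ≤ U) (hx : x ∈ U) (hy : y ∈ V)
    (s : Γ(M, U)) : toRat M hy (res M h s) = toRat M hx s :=
  germ_res M h (generic_mem hy) s

lemma toRat_add (M : X.Modules) {x : X} {U : X.Opens} (hx : x ∈ U) (s t : Γ(M, U)) :
    toRat M hx (s + t) = toRat M hx s + toRat M hx t :=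
  map_add (M.presheaf.germ U (genericPoint X) (generic_mem hx)).hom s t

lemma toRat_zero (M : X.Modules) {x : X} {U : X.Opens} (hx : x ∈ U) :
    toRat M hx (0 : Γ(M, U)) = 0 :=
  map_zero (M.presheaf.germ U (genericPoint X) (generic_mem hx)).hom

variable [X.Over SpecC]

lemma toRat_smul (M : X.Modules) {x : X} {U : X.Opens} (hx : x ∈ U) (c : ℂ) (s : Γ(M, U)) :
    toRat M hx (resO X (le_top : U ≤ ⊤) (constO X c) • s) = c • toRat M hx s := by
  refine (germ_smul M _ U (generic_mem hx) _ s).trans ?_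
  have : X.presheaf.germ U (genericPoint X) (generic_mem hx) (resO X (le_top : U ≤ ⊤) (constO X c)) =
      constStalk X (genericPoint X) c :=
    TopCat.Presheaf.germ_res_apply X.presheaf (homOfLE le_top) _ (generic_mem hx) (constO X c)
  rw [this]
  rfl

/-- The map on rational sections induced by a morphism. -/
def ratMap {M N : X.Modules} (f : M ⟶ N) : Rat M →ₗ[ℂ] Rat N where
  toFun := (TopCat.Presheaf.stalkFunctor Ab (genericPoint X)).map f.mapPresheaf
  map_add' := map_add ((TopCat.Presheaf.stalkFunctor Ab (genericPoint X)).map f.mapPresheaf).hom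
  map_smul' c r := by
    obtain ⟨U, hx, s, rfl⟩ := exists_toRat M r
    have key : ∀ s : Γ(M, U), (TopCat.Presheaf.stalkFunctor Ab (genericPoint X)).map f.mapPresheaf
        (toRat M hx s) = toRat N hx (f.app U s) := fun s ↦
      TopCat.Presheaf.stalkFunctor_map_germ_apply U (genericPoint X) _ f.mapPresheaf s
    rw [← toRat_smul, key, key, Scheme.Modules.Hom.app_smul, toRat_smul]
    rfl

lemma ratMap_toRat {M N : X.Modules} (f : M ⟶ N) {x : X} {U : X.Opens} (hx : x ∈ U)
    (s : Γ(M, U)) : ratMap f (toRat M hx s) = toRat N hx (f.app U s) :=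
  TopCat.Presheaf.stalkFunctor_map_germ_apply U (genericPoint X) _ f.mapPresheaf s

/-- The rational sections of `M` that are regular at `x`. -/
def regularAt (M : X.Modules) (x : X) : Submodule ℂ (Rat M) where
  carrier := {r | ∃ (U : X.Opens) (hx : x ∈ U) (s : Γ(M, U)), toRat M hx s = r}
  zero_mem' := ⟨⊤, trivial, 0, toRat_zero M _⟩
  add_mem' := by
    rintro _ _ ⟨U, hU, s, rfl⟩ ⟨V, hV, t, rfl⟩
    have h : x ∈ U ⊓ V := ⟨hU, hV⟩
    refine ⟨U ⊓ V, h, res M inf_le_left s + res M inf_le_right t, ?_⟩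
    rw [toRat_add, toRat_res M _ hU, toRat_res M _ hV]
  smul_mem' := by
    rintro c _ ⟨U, hU, s, rfl⟩
    exact ⟨U, hU, _, toRat_smul M hU c s⟩

lemma ratMap_regular {M N : X.Modules} (f : M ⟶ N) {x : X} {r : Rat M} (hr : r ∈ regularAt M x) :
    ratMap f r ∈ regularAt N x := by
  obtain ⟨U, hU, s, rfl⟩ := hr
  exact ⟨U, hU, f.app U s, (ratMap_toRat f hU s).symm⟩

/-- Families `(p_x)` of rational sections of `M`, indexed by the points of `X`, with `p_x` regular
at `x` for all but finitely many `x`. Such a family represents a principal part, and two families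
represent the same principal part if and only if `p_x - p'_x` is regular at `x` for all `x`.
(At the generic point every rational section is regular, so only closed points matter.) -/
def PrinRep (M : X.Modules) : Submodule ℂ (X → Rat M) where
  carrier := {p | {x | p x ∉ regularAt M x}.Finite}
  zero_mem' := by simp
  add_mem' := by
    intro p q hp hq
    refine (hp.union hq).subset fun x hx ↦ ?_
    by_contra h
    exact hx (add_mem (not_not.1 fun h1 ↦ h (Or.inl h1)) (not_not.1 fun h2 ↦ h (Or.inr h2)))
  smul_mem' := by
    intro c p hp
    exact hp.subset fun x hx h ↦ hx ((regularAt M x).smul_mem c h)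

/-- The families whose principal part is that of a global rational section. -/
def principal (M : X.Modules) : Submodule ℂ (PrinRep M) where
  carrier := {p | ∃ β : Rat M, ∀ x, p.1 x - β ∈ regularAt M x}
  zero_mem' := ⟨0, fun x ↦ by simp⟩
  add_mem' := by
    rintro p q ⟨β, hβ⟩ ⟨γ, hγ⟩
    refine ⟨β + γ, fun x ↦ ?_⟩
    have := add_mem (hβ x) (hγ x)
    rwa [sub_add_sub_comm] at this
  smul_mem' := by
    rintro c p ⟨β, hβ⟩
    refine ⟨c • β, fun x ↦ ?_⟩
    have := (regularAt M x).smul_mem c (hβ x)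
    rwa [smul_sub] at this

/-- `H¹(X, M)`, computed by the flasque resolution `0 → M → Rat(M) → Prin(M) → 0` as the
cokernel of `Rat(M) → Prin(M)` on global sections. -/
def H1 (M : X.Modules) : Type := PrinRep M ⧸ principal M

instance (M : X.Modules) : AddCommGroup (H1 M) :=
  inferInstanceAs (AddCommGroup (PrinRep M ⧸ principal M))

instance (M : X.Modules) : Module ℂ (H1 M) :=
  inferInstanceAs (Module ℂ (PrinRep M ⧸ principal M))

/-- The class `[p]` in `H¹` of a principal part. -/
def H1.mk (M : X.Modules) : PrinRep M →ₗ[ℂ] H1 M := (principal M).mkQ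

/-- The map on principal parts induced by a morphism. -/
def prinMap {M N : X.Modules} (f : M ⟶ N) : PrinRep M →ₗ[ℂ] PrinRep N where
  toFun p := ⟨fun x ↦ ratMap f (p.1 x), p.2.subset fun _ hx h ↦ hx (ratMap_regular f h)⟩
  map_add' p q := Subtype.ext (funext fun x ↦ map_add (ratMap f) _ _)
  map_smul' c p := Subtype.ext (funext fun x ↦ map_smul (ratMap f) _ _)

/-- The map on `H¹` induced by a morphism. -/
def H1.map {M N : X.Modules} (f : M ⟶ N) : H1 M →ₗ[ℂ] H1 N :=
  (principal M).mapQ (principal N) (prinMap f) (by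
    rintro p ⟨β, hβ⟩
    refine ⟨ratMap f β, fun x ↦ ?_⟩
    have := ratMap_regular f (hβ x)
    rwa [map_sub] at this)

open Classical in
/-- The principal part supported at `x` represented there by the rational section `r`. -/
def prinAt {M : X.Modules} (x : X) (r : Rat M) : PrinRep M :=
  ⟨Pi.single x r, (Set.finite_singleton x).subset fun y hy ↦ by
    by_contra h
    refine hy ?_
    rw [Pi.single_eq_of_ne h]
    exact zero_mem _⟩

/-- `e ∈ H¹(Hom(Q, F))` is the class of the extension `0 → F → W → Q → 0` with maps `i`, `π`:
there is a rational splitting `σ : Q ⇢ W` of `π` and a principal part `p` representing `e` such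
that `σ + i ∘ p_x : Q → W` is regular at every point `x`, i.e. is a regular local splitting.
Equivalently `e` is the image of `id_Q` under the connecting map `H⁰(Hom(Q, Q)) → H¹(Hom(Q, F))`,
and `σ` identifies `W` with the sheaf of pairs `(f, φ)` in `Rat(F) ⊕ Q` such that `f - p(φ)`
is regular. -/
def IsExtensionClass {F W Q : X.Modules} (i : F ⟶ W) (π : W ⟶ Q) (e : H1 (sheafHom Q F)) : Prop :=
  ∃ σ : Rat (sheafHom Q W),
    ratMap (postcomp Q π) σ = toRat (sheafHom Q Q) (U := ⊤) (Opens.mem_top (genericPoint X)) (idSec Q) ∧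
    ∃ p : PrinRep (sheafHom Q F), H1.mk _ p = e ∧
      ∀ x, σ + ratMap (postcomp Q i) (p.1 x) ∈ regularAt (sheafHom Q W) x

end H1

/-! ### Symplectic extensions -/

/-- Evaluation of a section of `Hom(M, N)` on a section of `M`. -/
def ev {M N : X.Modules} {U : X.Opens} (φ : Γ(sheafHom M N, U)) (m : Γ(M, U)) : Γ(N, U) :=
  HomSec.app φ U le_rfl m

/-- An `L`-valued symplectic form on `W`, viewed as a morphism `w ↦ ω(w, ·)` from `W` to
`Hom(W, L)`: it is alternating and nondegenerate. -/
structure IsSymplectic {W L : X.Modules} (ω : W ⟶ sheafHom W L) : Prop where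
  alternating : ∀ (U : X.Opens) (w : Γ(W, U)), ev (ω.app U w) w = 0
  nondegenerate : IsIso ω

/-- The image of `j : E ⟶ W` is isotropic for `ω`. -/
def IsIsotropic {E W L : X.Modules} (ω : W ⟶ sheafHom W L) (j : E ⟶ W) : Prop :=
  ∀ (U : X.Opens) (s t : Γ(E, U)), ev (ω.app U (j.app U s)) (j.app U t) = 0

/-- `i : F ⟶ W` is a vector subbundle: it is injective on all fibres. -/
def IsSubbundle {F W : X.Modules} (i : F ⟶ W) : Prop :=
  ∀ (x : X) (U : X.Opens) (hx : x ∈ U) (s : Γ(F, U)),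
    value W hx (i.app U s) = 0 → value F hx s = 0

/-- `j : E ⟶ W` is a Lagrangian subsheaf of the symplectic bundle `(W, ω)` of rank `2n`: an
isotropic subsheaf of rank `n`. -/
structure IsLagrangianSubsheaf [IsIntegral X] (n : ℕ) {E W L : X.Modules} (ω : W ⟶ sheafHom W L)
    (j : E ⟶ W) : Prop where
  mono : Mono j
  isotropic : IsIsotropic ω j
  rank : Module.finrank X.functionField (Rat E) = n

/-- The map `W ⟶ Hom(F, L) = F* ⊗ L`, `w ↦ ω(w, i ·)`, induced by the form `ω`; if `F` is a
Lagrangian subbundle it is the quotient map of the symplectic extension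
`0 → F → W → F* ⊗ L → 0`. -/
def quotMap {F W L : X.Modules} (ω : W ⟶ sheafHom W L) (i : F ⟶ W) : W ⟶ sheafHom F L :=
  ω ≫ precomp i L

/-! ### The map `ψ` and elementary transformations -/

/-- The dual `L⁻¹ = Hom(L, O)` of a line bundle `L`. -/
def dual (L : X.Modules) : X.Modules := sheafHom L (structureModule X)

/-- The section `λ ⊗ s ⊗ s` of `L⁻¹ ⊗ F ⊗ F = Hom(Hom(F, L), F)`, that is `φ ↦ λ(φ(s)) s`. -/
def squareSec {F L : X.Modules} {U : X.Opens} (l : Γ(dual L, U)) (s : Γ(F, U)) :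
    Γ(sheafHom (sheafHom F L) F, U) :=
  let l' : HomSec L (structureModule X) U := l
  let c (V : X.Opens) (hV : V ≤ U) : HomSec F L V →ₗ[Γ(X, V)] Γ(X, V) :=
    { toFun := fun φ ↦ (l'.app V hV (φ.app V le_rfl (res F hV s)) : Γ(X, V))
      map_add' := fun φ φ' ↦ map_add (l'.app V hV) _ _
      map_smul' := fun r φ ↦ by
        change l'.app V hV (resO X le_rfl r • φ.app V le_rfl (res F hV s)) = _
        rw [resO_self]
        exact (l'.app V hV).map_smul r _ }
  ({ app := fun V hV ↦ (c V hV).smulRight (res F hV s)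
     app_res := fun V T hV hT (m : HomSec F L V) ↦ by
      have h1 : m.app T hT (res F (hT.trans hV) s) = res L hT (m.app V le_rfl (res F hV s)) := by
        rw [← m.app_res V T le_rfl hT, res_res]
      have h2 : c T (hT.trans hV) (HomSec.restrict hT m) = resO X hT (c V hV m) :=
        (congr_arg (l'.app T (hT.trans hV)) h1).trans (l'.app_res V T hV hT _)
      change c T (hT.trans hV) (HomSec.restrict hT m) • res F (hT.trans hV) s =
        res F hT (c V hV m • res F hV s)
      rw [res_smul, res_res, h2] } : HomSec (sheafHom F L) F U)

/-- `P = ψ(η)`, where `ψ : ℙF ⇢ ℙH¹(L⁻¹ ⊗ Sym² F)` is the natural rational map: for `η` in the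
fibre of `ℙF` over the point `x`, spanned by the value at `x` of a local section `s` of `F`, the
point `ψ(η)` is defined if the class in `H¹` of the principal part `λ ⊗ s ⊗ s / z` at `x` is
nonzero, and is then the line spanned by this class. Here `λ` is a local generator of `L⁻¹` and `z`
is a uniformizer at `x`. -/
def IsPsi [IsIntegral X] [X.Over SpecC] {F L : X.Modules} {x : X} (η : ℙ ℂ (Fiber F x))
    (P : ℙ ℂ (H1 (symHom F L))) : Prop :=
  ∃ (U : X.Opens) (hx : x ∈ U) (s : Γ(F, U)) (hs : value F hx s ≠ 0) (l : Γ(dual L, U))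
    (a : Γ(symHom F L, U)) (z : X.presheaf.stalk x)
    (h0 : H1.mk (symHom F L)
      (prinAt x ((algebraMap (X.presheaf.stalk x) X.functionField z)⁻¹ • toRat _ hx a)) ≠ 0),
    Projectivization.mk ℂ (value F hx s) hs = η ∧
    IsFrame (M := dual L) (fun _ : Fin 1 ↦ l) ∧
    (symHomι F L).app U a = squareSec l s ∧
    Irreducible z ∧
    Projectivization.mk ℂ _ h0 = P

/-- The section `φ` of `Hom(F, L) = F* ⊗ L` takes values in `Ker(η)` at `x` (if it is defined
there): `φ(s)` vanishes at `x` for all local sections `s` of `F` whose value at `x` is in the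
line `η`. -/
def TakesValuesInKer [X.Over SpecC] {F L : X.Modules} {U : X.Opens} (φ : Γ(sheafHom F L, U))
    {x : X} (η : ℙ ℂ (Fiber F x)) : Prop :=
  ∀ (V : X.Opens) (hV : V ≤ U) (hx : x ∈ V) (s : Γ(F, V)),
    value F hx s ∈ η.submodule → value L hx (ev (res (sheafHom F L) hV φ) s) = 0

end LagLift

end

noncomputable section

namespace LagLift

section

/-! ### Points of a curve -/

variable {C : Scheme.{0}} [C.Over SpecC] [IsSmoothProjectiveCurve C]

/-! Write `K` for the function field and `Q` for `F* ⊗ L`. The argument is linear algebra over `K`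
with a notion of regularity at each point. A rational section of `Hom(M, N)`, with `M` a vector
bundle, is a `K`-linear map `Rat M → Rat N`, and it is regular at `x` exactly when it preserves
regularity at `x` (`mem_regularAt_sheafHom_iff`). A `K`-linear map that preserves regularity at all
points comes from a morphism if the target is torsion free (`exists_hom_of_ratMap`).

The class. Since `F` is a subbundle, it is a direct summand near each point (`exists_retraction`).
The form `ω` turns a retraction onto `F` into a regular splitting of `π`, which becomes isotropic
after a correction with the factor `1/2` (`exists_splitting`). Two isotropic splittings differ by a
symmetric map `Q → F`. Comparing one rational isotropic splitting `σ` with a regular one at each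
point `x` gives symmetric maps `p x` with `σ + i ∘ p x` regular at `x`, and `δ(W)` is the class of
the family `p` (`exists_class`). It is unique because a rational `β` bounding a symmetric principal
part can be replaced by `(β + βᵗ)/2` (`exists_symmetrization`).

Lifting. The map `γ` is bijective on rational sections, so a Lagrangian lift of `E` is an isotropic
splitting `σ + i ∘ b`, with `b` symmetric, that maps `E` to regular sections of `W`. Subtracting it
from `σ + i ∘ p x` shows that this means: `p x - b` maps `E` to regular sections of `F` at every
`x`. Hence `E` lifts if and only if `δ(W)` has a representative that is regular on `E`
(`exists_lagrangianSubsheaf_iff`).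

Local computation. By symmetry, a principal part at `x k` that is regular on `E` has a simple pole
in the direction `s ⊗ s` only, so it is a complex multiple of `λ ⊗ s ⊗ s / z`
(`IsPsiSection.exists_sub_mem`); elsewhere it is regular. The classes of such principal parts
therefore form the span of the `v_η` (`submodule_span_eq`). -/

lemma genericPoint_not_isClosed : ¬ IsClosed ({genericPoint C} : Set C) := fun h ↦
  have := IsSmoothProjectiveCurve.isDVR _ h
  IsDiscreteValuationRing.not_isField (C.presheaf.stalk (genericPoint C))
    (Field.toIsField C.functionField)

lemma isNoetherian_of_curve : IsNoetherian C := by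
  have := IsSmoothProjectiveCurve.isProper (C := C)
  have : IsLocallyNoetherian C := LocallyOfFiniteType.isLocallyNoetherian (C ↘ SpecC)
  have : CompactSpace C := QuasiCompact.compactSpace_of_compactSpace (C ↘ SpecC)
  exact {}

/-- The point `y` specializes to a closed point `x`, hence comes from the spectrum of the discrete
valuation ring at `x`. That spectrum has only two points, which map to the generic point and to `x`.
-/
lemma isClosed_of_ne_genericPoint {y : C} (hy : y ≠ genericPoint C) :
    IsClosed ({y} : Set C) := by
  have := isNoetherian_of_curve (C := C)
  obtain ⟨x, hxy, hx⟩ := IsClosed.exists_closed_singleton (isClosed_closure (s := {y}))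
    ⟨y, subset_closure rfl⟩
  have := IsSmoothProjectiveCurve.isDVR _ hx
  have h1 : y ∈ Set.range (C.fromSpecStalk x) := by
    rw [Scheme.range_fromSpecStalk]
    exact specializes_iff_mem_closure.2 hxy
  obtain ⟨p, hp⟩ := h1
  by_cases hp0 : p.asIdeal = ⊥
  · refine absurd ?_ hy
    have h2 : genericPoint C ∈ Set.range (C.fromSpecStalk x) := by
      rw [Scheme.range_fromSpecStalk]
      exact genericPoint_specializes x
    obtain ⟨q, hq⟩ := h2
    have hpq : p ⤳ q := by
      exact (PrimeSpectrum.le_iff_specializes p q).1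
        (show p.asIdeal ≤ q.asIdeal by rw [hp0]; exact bot_le)
    have := hpq.map (C.fromSpecStalk x).continuous
    rw [hp, hq] at this
    exact (this.antisymm (genericPoint_specializes y)).eq
  · have hmax := IsLocalRing.eq_maximalIdeal (p.isPrime.isMaximal hp0)
    have : p = IsLocalRing.closedPoint (C.presheaf.stalk x) := PrimeSpectrum.ext hmax
    rw [this, Scheme.fromSpecStalk_closedPoint] at hp
    rwa [← hp]

/-- The complement is a finite union of irreducible closed sets by Noetherianity. The generic point
of each is not that of `C`, hence is closed. -/
lemma finite_compl {U : C.Opens} (hU : genericPoint C ∈ U) : {x : C | x ∉ U}.Finite := by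
  have := isNoetherian_of_curve (C := C)
  obtain ⟨S, hS, hS', hS'', h⟩ := NoetherianSpace.exists_finite_set_isClosed_irreducible
    (U.isOpen.isClosed_compl)
  have h' : {x : C | x ∉ U} = ⋃₀ S := h
  rw [h']
  refine hS.sUnion fun t ht ↦ ?_
  obtain ⟨y, hy⟩ := QuasiSober.sober (hS'' t ht) (hS' t ht)
  have hyU : y ∉ U := h'.ge ⟨t, ht, hy.mem⟩
  have hc := isClosed_of_ne_genericPoint (y := y) (by rintro rfl; exact hyU hU)
  rw [← hy.def, hc.closure_eq]
  exact Set.finite_singleton y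

/-- By the Nullstellensatz the residue field at a closed point is `ℂ`. The work lies in identifying
this isomorphism with the evaluation of constants. -/
lemma exists_const_sub_mem {x : C} (hx : IsClosed ({x} : Set C)) (c : C.presheaf.stalk x) :
    ∃ a : ℂ, c - constStalk C x a ∈ IsLocalRing.maximalIdeal (C.presheaf.stalk x) := by
  have := IsSmoothProjectiveCurve.isProper (C := C)
  have h := SpecMap_residueFieldIsoBase_inv (K := ℂ) (C ↘ SpecC) x hx
  have h1 : (residueFieldIsoBase (K := ℂ) (C ↘ SpecC) x hx).inv =
      (Scheme.ΓSpecIso (CommRingCat.of ℂ)).inv ≫ (C ↘ SpecC).appTop ≫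
        C.presheaf.germ ⊤ x trivial ≫ C.residue x := by
    have h2 := congr_arg (fun f ↦ (Scheme.ΓSpecIso (CommRingCat.of ℂ)).inv ≫
      Scheme.Hom.appTop f ≫ (Scheme.ΓSpecIso _).hom) h
    simp only [Scheme.ΓSpecIso_naturality, Iso.inv_hom_id_assoc, Scheme.Hom.comp_appTop,
      Category.assoc, Scheme.fromSpecResidueField, Scheme.fromSpecStalk_appTop] at h2
    rw [h2]
    have : (Spec (C.presheaf.stalk x)).presheaf.map (homOfLE (le_top : (⊤ : (Spec
      (C.presheaf.stalk x)).Opens) ≤ ⊤)).op = 𝟙 _ := by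
      rw [← CategoryTheory.Functor.map_id]; rfl
    erw [this]
    simp
  obtain ⟨a, ha⟩ : ∃ a, (residueFieldIsoBase (K := ℂ) (C ↘ SpecC) x hx).inv a = C.residue x c :=
    ⟨(residueFieldIsoBase (K := ℂ) (C ↘ SpecC) x hx).hom (C.residue x c), by simp⟩
  refine ⟨a, ?_⟩
  rw [h1] at ha
  rw [← IsLocalRing.residue_eq_zero_iff, map_sub, sub_eq_zero]
  exact ha.symm

end

/-! ### Frames and stalks -/

section Frames

variable {X : Scheme.{0}}

lemma exists_res_eq (M : X.Modules) {x : X} {U V : X.Opens} (hU : x ∈ U) (hV : x ∈ V)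
    (s : Γ(M, U)) (t : Γ(M, V)) (h : M.presheaf.germ U x hU s = M.presheaf.germ V x hV t) :
    ∃ (T : X.Opens) (hTU : T ≤ U) (hTV : T ≤ V), x ∈ T ∧ res M hTU s = res M hTV t := by
  obtain ⟨T, hT, iU, iV, e⟩ := M.presheaf.germ_eq x hU hV s t h
  exact ⟨T, iU.le, iV.le, hT, e⟩

lemma germ_resO {x : X} {U V : X.Opens} (h : V ≤ U) (hx : x ∈ V) (f : Γ(X, U)) :
    X.presheaf.germ V x hx (resO X h f) = X.presheaf.germ U x (h hx) f :=
  TopCat.Presheaf.germ_res_apply X.presheaf (homOfLE h) x hx f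

lemma exists_germ_eq_le (M : X.Modules) {x : X} {U : X.Opens} (hU : x ∈ U) {ι : Type} [Finite ι]
    (c : ι → M.presheaf.stalk x) : ∃ (V : X.Opens) (_ : V ≤ U) (hx : x ∈ V) (s : ι → Γ(M, V)),
      ∀ i, M.presheaf.germ V x hx (s i) = c i := by
  have := Fintype.ofFinite ι
  choose V hV s hs using fun i ↦ TopCat.Presheaf.exists_germ_eq M.presheaf (c i)
  have hx : x ∈ U ⊓ Finset.univ.inf V := ⟨hU, by
    change x ∈ ((Finset.univ.inf V : X.Opens) : Set X)
    rw [Opens.coe_finset_inf]; simpa using hV⟩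
  exact ⟨_, inf_le_left, hx, fun i ↦ res M (inf_le_right.trans (Finset.inf_le (Finset.mem_univ i)))
    (s i), fun i ↦ (germ_res M _ _ _).trans (hs i)⟩

lemma exists_germO_eq_le {x : X} {U : X.Opens} (hU : x ∈ U) {ι : Type} [Finite ι]
    (c : ι → X.presheaf.stalk x) : ∃ (V : X.Opens) (_ : V ≤ U) (hx : x ∈ V) (s : ι → Γ(X, V)),
      ∀ i, X.presheaf.germ V x hx (s i) = c i := by
  have := Fintype.ofFinite ι
  choose V hV s hs using fun i ↦ TopCat.Presheaf.exists_germ_eq X.presheaf (c i)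
  have hx : x ∈ U ⊓ Finset.univ.inf V := ⟨hU, by
    change x ∈ ((Finset.univ.inf V : X.Opens) : Set X)
    rw [Opens.coe_finset_inf]; simpa using hV⟩
  exact ⟨_, inf_le_left, hx, fun i ↦ resO X (inf_le_right.trans (Finset.inf_le (Finset.mem_univ i)))
    (s i), fun i ↦ (germ_resO _ _ _).trans (hs i)⟩

variable {M N : X.Modules} {U : X.Opens} {n : ℕ} {e : Fin n → Γ(M, U)}

lemma IsFrame.res (he : IsFrame e) {V : X.Opens} (h : V ≤ U) :
    IsFrame fun i ↦ res M h (e i) := fun T hT ↦ by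
  simpa only [res_res] using he T (hT.trans h)

lemma germ_sum_smul {x : X} (hx : x ∈ U) (c : Fin n → Γ(X, U)) (e : Fin n → Γ(M, U)) :
    M.presheaf.germ U x hx (∑ i, c i • e i) =
      ∑ i, X.presheaf.germ U x hx (c i) • M.presheaf.germ U x hx (e i) := by
  simp [germ_smul]

lemma IsFrame.germ_bijective (he : IsFrame e) {x : X} (hx : x ∈ U) :
    Function.Bijective (Fintype.linearCombination (X.presheaf.stalk x)
      fun i ↦ M.presheaf.germ U x hx (e i)) := by
  constructor
  · rw [injective_iff_map_eq_zero]
    intro c hc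
    obtain ⟨V, hVU, hxV, f, rfl'⟩ := exists_germO_eq_le hx c
    obtain rfl : (fun i ↦ X.presheaf.germ V x hxV (f i)) = c := funext rfl'
    have h1 : M.presheaf.germ V x hxV (∑ i, f i • LagLift.res M hVU (e i)) =
        M.presheaf.germ V x hxV 0 := by
      rw [germ_sum_smul, map_zero]
      simpa only [germ_res, Fintype.linearCombination_apply] using hc
    obtain ⟨T, hT, _, hxT, h2⟩ := exists_res_eq M hxV hxV _ _ h1
    simp only [map_sum, res_smul, res_res, map_zero] at h2
    have h3 : (fun i ↦ resO X hT (f i)) = 0 := (he T (hT.trans hVU)).1 (by simpa using h2)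
    funext i
    have : resO X hT (f i) = 0 := congr_fun h3 i
    rw [← germ_resO hT hxT, this]
    simp
  · intro t
    obtain ⟨V, hVU, hxV, s, hs⟩ := exists_germ_eq_le M hx fun _ : Fin 1 ↦ t
    obtain ⟨c, hc⟩ := (he V hVU).2 (s 0)
    refine ⟨fun i ↦ X.presheaf.germ V x hxV (c i), ?_⟩
    rw [← hs 0, ← hc, germ_sum_smul]
    simp only [germ_res, Fintype.linearCombination_apply]

/-- The basis of the stalk at a point given by a frame. -/
def IsFrame.stalkBasis (he : IsFrame e) {x : X} (hx : x ∈ U) :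
    Module.Basis (Fin n) (X.presheaf.stalk x) (M.presheaf.stalk x) :=
  .ofEquivFun (LinearEquiv.ofBijective _ (he.germ_bijective hx)).symm

lemma IsFrame.stalkBasis_apply (he : IsFrame e) {x : X} (hx : x ∈ U) (i : Fin n) :
    he.stalkBasis hx i = M.presheaf.germ U x hx (e i) := by
  simp [stalkBasis, LinearEquiv.symm_symm, Fintype.linearCombination_apply, Pi.single_apply,
    ite_smul]

/-- The coordinate isomorphism on sections given by a frame. -/
def IsFrame.coord (he : IsFrame e) {V : X.Opens} (h : V ≤ U) :
    (Fin n → Γ(X, V)) ≃ₗ[Γ(X, V)] Γ(M, V) :=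
  LinearEquiv.ofBijective (Fintype.linearCombination _ fun i ↦ LagLift.res M h (e i)) (he V h)

lemma IsFrame.coord_apply (he : IsFrame e) {V : X.Opens} (h : V ≤ U) (c : Fin n → Γ(X, V)) :
    he.coord h c = ∑ i, c i • LagLift.res M h (e i) := rfl

/-- The homomorphism with prescribed values on a frame. -/
def IsFrame.constr (he : IsFrame e) (t : Fin n → Γ(N, U)) : HomSec M N U where
  app V h := (Fintype.linearCombination _ fun i ↦ LagLift.res N h (t i)) ∘ₗ (he.coord h).symm
  app_res V T hV hT m := by
    obtain ⟨c, rfl⟩ := (he.coord hV).surjective m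
    have : LagLift.res M hT (he.coord hV c) =
        he.coord (hT.trans hV) fun i ↦ resO X hT (c i) := by
      simp only [coord_apply, map_sum, res_smul, res_res]
    rw [this]
    simp [Fintype.linearCombination_apply, res_smul, res_res]

lemma IsFrame.constr_app (he : IsFrame e) (t : Fin n → Γ(N, U)) (i : Fin n) :
    (he.constr t).app U le_rfl (e i) = t i := by
  have : e i = he.coord le_rfl (Pi.single i 1) := by
    simp [coord_apply, Pi.single_apply, ite_smul, res_self]
  conv_lhs => rw [this]
  simp [constr, Fintype.linearCombination_apply, Pi.single_apply, ite_smul, res_self]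

lemma IsFrame.homSec_ext (he : IsFrame e) {α β : HomSec M N U}
    (h : ∀ i, α.app U le_rfl (e i) = β.app U le_rfl (e i)) : α = β := by
  refine HomSec.ext (funext fun V ↦ funext fun hV ↦ LinearMap.ext fun m ↦ ?_)
  obtain ⟨c, rfl⟩ := (he V hV).2 m
  simp [α.app_res U V le_rfl hV, β.app_res U V le_rfl hV, h]

end Frames

/-! ### Rational sections -/

section Rational

variable {X : Scheme.{0}} [IsIntegral X]

/-- Sections are determined by the rational sections that they define. -/
def IsTorsionFree (M : X.Modules) : Prop :=
  ∀ (U : X.Opens) (x : X) (hx : x ∈ U) (s : Γ(M, U)), toRat M hx s = 0 → s = 0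

lemma toRat_sub (M : X.Modules) {x : X} {U : X.Opens} (hx : x ∈ U) (s t : Γ(M, U)) :
    toRat M hx (s - t) = toRat M hx s - toRat M hx t :=
  map_sub (M.presheaf.germ U (genericPoint X) (generic_mem hx)).hom s t

lemma IsTorsionFree.eq {M : X.Modules} (hM : IsTorsionFree M) {U : X.Opens} {s t : Γ(M, U)}
    (h : ∀ (x : X) (hx : x ∈ U), toRat M hx s = toRat M hx t) : s = t := by
  by_cases hU : ∃ x, x ∈ U
  · obtain ⟨x, hx⟩ := hU
    refine sub_eq_zero.1 (hM U x hx _ ?_)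
    rw [toRat_sub, h x hx, sub_self]
  · exact eq_of_local M fun x hx ↦ (hU ⟨x, hx⟩).elim

/-- A rational function as the germ of a function. -/
lemma exists_germ_functionField (c : X.functionField) :
    ∃ (U : X.Opens) (hU : genericPoint X ∈ U) (f : Γ(X, U)), X.presheaf.germ U _ hU f = c :=
  TopCat.Presheaf.exists_germ_eq X.presheaf c

lemma toRat_fsmul (M : X.Modules) {x : X} {U : X.Opens} (hx : x ∈ U) (f : Γ(X, U))
    (s : Γ(M, U)) : toRat M hx (f • s) =
      (X.presheaf.germ U (genericPoint X) (generic_mem hx) f : X.functionField) • toRat M hx s :=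
  germ_smul M _ U (generic_mem hx) f s

lemma algebraMap_germ {x : X} {U : X.Opens} (hx : x ∈ U) (f : Γ(X, U)) :
    algebraMap (X.presheaf.stalk x) X.functionField (X.presheaf.germ U x hx f) =
      X.presheaf.germ U (genericPoint X) (generic_mem hx) f :=
  TopCat.Presheaf.germ_stalkSpecializes_apply X.presheaf _ _ _

lemma toRat_eq_iff (M : X.Modules) {x y : X} {U V : X.Opens} (hx : x ∈ U) (hy : y ∈ V)
    (s : Γ(M, U)) (t : Γ(M, V)) (h : toRat M hx s = toRat M hy t) :
    ∃ (T : X.Opens) (hTU : T ≤ U) (hTV : T ≤ V), genericPoint X ∈ T ∧ res M hTU s = res M hTV t :=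
  exists_res_eq M (generic_mem hx) (generic_mem hy) s t h

lemma exists_toRat_le (M : X.Modules) (r : Rat M) {U : X.Opens} (hU : genericPoint X ∈ U) :
    ∃ (V : X.Opens) (_ : V ≤ U) (hV : genericPoint X ∈ V) (s : Γ(M, V)), toRat M hV s = r := by
  obtain ⟨V, hV, s, rfl⟩ := exists_toRat M r
  exact ⟨V ⊓ U, inf_le_right, ⟨hV, hU⟩, res M inf_le_left s, toRat_res _ _ hV _ _⟩

lemma exists_toRat₂ (M N : X.Modules) (r : Rat M) (q : Rat N) :
    ∃ (V : X.Opens) (hV : genericPoint X ∈ V) (s : Γ(M, V)) (t : Γ(N, V)),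
      toRat M hV s = r ∧ toRat N hV t = q := by
  obtain ⟨U, hU, s, rfl⟩ := exists_toRat M r
  obtain ⟨V, hVU, hV, t, rfl⟩ := exists_toRat_le N q hU
  exact ⟨V, hV, res M hVU s, t, toRat_res _ _ hU _ _, rfl⟩

lemma exists_toRat₃ (M N P : X.Modules) (r : Rat M) (q : Rat N) (p : Rat P) :
    ∃ (V : X.Opens) (hV : genericPoint X ∈ V) (s : Γ(M, V)) (t : Γ(N, V)) (u : Γ(P, V)),
      toRat M hV s = r ∧ toRat N hV t = q ∧ toRat P hV u = p := by
  obtain ⟨U, hU, s, t, rfl, rfl⟩ := exists_toRat₂ M N r q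
  obtain ⟨V, hVU, hV, u, rfl⟩ := exists_toRat_le P p hU
  exact ⟨V, hV, res M hVU s, res N hVU t, u, toRat_res _ _ hU _ _, toRat_res _ _ hU _ _, rfl⟩

lemma exists_toRat_smul (M : X.Modules) (c : X.functionField) (r : Rat M) {U : X.Opens}
    (hU : genericPoint X ∈ U) :
    ∃ (V : X.Opens) (_ : V ≤ U) (hV : genericPoint X ∈ V) (f : Γ(X, V)) (s : Γ(M, V)),
      X.presheaf.germ V _ hV f = c ∧ toRat M hV s = r ∧ toRat M hV (f • s) = c • r := by
  obtain ⟨T, hT, f, rfl⟩ := exists_germ_functionField c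
  obtain ⟨V, hVU, hV, s, rfl⟩ := exists_toRat_le M r (U := U ⊓ T) ⟨hU, hT⟩
  refine ⟨V, hVU.trans inf_le_left, hV, resO X (hVU.trans inf_le_right) f, s,
    germ_resO _ _ _, rfl, ?_⟩
  rw [toRat_fsmul, germ_resO]

/-- Representatives of the same germs agree near the generic point, so the value does not depend on
them. Independence is built into the statement so that `ratHom` can be defined by choice. -/
lemma exists_ratEv {M N : X.Modules} (r : Rat (sheafHom M N)) (m : Rat M) :
    ∃ q : Rat N, ∀ (U V : X.Opens) (x y : X) (hx : x ∈ U) (hy : y ∈ V) (α : HomSec M N U)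
      (s : Γ(M, V)) (h : V ≤ U), toRat (sheafHom M N) hx α = r → toRat M hy s = m →
      toRat N hy (α.app V h s) = q := by
  obtain ⟨T, hT, (β : HomSec M N T), t, rfl, rfl⟩ := exists_toRat₂ (sheafHom M N) M r m
  refine ⟨toRat N hT (β.app T le_rfl t), fun U V x y hx hy α s h h1 h2 ↦ ?_⟩
  obtain ⟨A, hAU, hAT, hA, h3⟩ := toRat_eq_iff _ _ _ _ _ h1
  obtain ⟨B, hBV, hBT, hB, h4⟩ := toRat_eq_iff _ _ _ _ _ h2
  have hAB : genericPoint X ∈ A ⊓ B := ⟨hA, hB⟩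
  rw [← toRat_res N (inf_le_right.trans hBV) hy hAB, ← toRat_res N (inf_le_right.trans hBT) hT hAB,
    ← α.app_res V _ h, ← β.app_res T _ le_rfl]
  have h5 : res M (inf_le_right.trans hBV : A ⊓ B ≤ V) s = res M (inf_le_right.trans hBT) t := by
    rw [← res_res M hBV inf_le_right, h4, res_res]
  rw [h5]
  have h6 := congr_arg (fun a : HomSec M N A ↦ a.app (A ⊓ B) inf_le_left) h3
  exact congr_arg (toRat N hAB) congr($h6 (res M (inf_le_right.trans hBT) t))

/-- The `K`-linear map between rational sections defined by a rational section of `Hom(M, N)`. -/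
def ratHom (M N : X.Modules) :
    Rat (sheafHom M N) →ₗ[X.functionField] Rat M →ₗ[X.functionField] Rat N :=
  have key {M N : X.Modules} {U : X.Opens} (hU : genericPoint X ∈ U) (α : Γ(sheafHom M N, U))
      (s : Γ(M, U)) : (exists_ratEv (toRat _ hU α) (toRat _ hU s)).choose =
        toRat N hU (HomSec.app α U le_rfl s) :=
    ((exists_ratEv (toRat _ hU α) (toRat _ hU s)).choose_spec U U _ _ hU hU α s le_rfl rfl rfl).symm
  LinearMap.mk₂ _ (fun r m ↦ (exists_ratEv r m).choose)
    (fun r q m ↦ by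
      obtain ⟨U, hU, a, b, s, rfl, rfl, rfl⟩ := exists_toRat₃ _ _ _ r q m
      rw [← toRat_add, key, key, key, ← toRat_add]
      rfl)
    (fun c r m ↦ by
      obtain ⟨U, hU, s, rfl⟩ := exists_toRat _ m
      obtain ⟨V, hVU, hV, f, a, rfl, rfl, h⟩ := exists_toRat_smul _ c r hU
      rw [← h, ← toRat_res M hVU hU hV, key, key, ← toRat_fsmul]
      refine congr_arg (toRat N hV) ?_
      change resO X le_rfl f • HomSec.app a V le_rfl (res M hVU s) = _
      rw [resO_self])
    (fun r m q ↦ by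
      obtain ⟨U, hU, a, s, t, rfl, rfl, rfl⟩ := exists_toRat₃ _ _ _ r m q
      rw [← toRat_add, key, key, key, ← toRat_add, map_add])
    (fun c r m ↦ by
      obtain ⟨U, hU, a, rfl⟩ := exists_toRat _ r
      obtain ⟨V, hVU, hV, f, s, rfl, rfl, h⟩ := exists_toRat_smul _ c m hU
      rw [← h, ← toRat_res _ hVU hU hV, key, key, ← toRat_fsmul, map_smul])

lemma ratHom_toRat {M N : X.Modules} {U V : X.Opens} {x y : X} (hx : x ∈ U) (hy : y ∈ V)
    (h : V ≤ U) (α : Γ(sheafHom M N, U)) (s : Γ(M, V)) :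
    ratHom M N (toRat _ hx α) (toRat M hy s) = toRat N hy (HomSec.app α V h s) :=
  ((exists_ratEv (toRat _ hx α) (toRat _ hy s)).choose_spec U V _ _ hx hy α s h rfl rfl).symm

section Frame

variable {M N : X.Modules} {U : X.Opens} {n : ℕ} {e : Fin n → Γ(M, U)}

/-- The basis of the space of rational sections given by a frame. -/
def IsFrame.ratBasis (he : IsFrame e) {x : X} (hx : x ∈ U) :
    Module.Basis (Fin n) X.functionField (Rat M) :=
  he.stalkBasis (generic_mem hx)

lemma IsFrame.ratBasis_apply (he : IsFrame e) {x : X} (hx : x ∈ U) (i : Fin n) :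
    he.ratBasis hx i = toRat M hx (e i) :=
  he.stalkBasis_apply (generic_mem hx) i

lemma toRat_sum_smul {x : X} (hx : x ∈ U) (c : Fin n → Γ(X, U)) (e : Fin n → Γ(M, U)) :
    toRat M hx (∑ i, c i • e i) = ∑ i,
      (X.presheaf.germ U (genericPoint X) (generic_mem hx) (c i) : X.functionField) •
        toRat M hx (e i) :=
  germ_sum_smul (generic_mem hx) c e

end Frame

/-- In a local frame the coefficients vanish at the generic point, and on an integral scheme
functions inject into `K`. -/
lemma IsVectorBundle.isTorsionFree {M : X.Modules} {n : ℕ} (hM : IsVectorBundle M n) :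
    IsTorsionFree M := by
  intro U x hx s hs
  refine eq_of_local M fun y hy ↦ ?_
  obtain ⟨V, hyV, e, he⟩ := hM y
  have hyT : y ∈ U ⊓ V := ⟨hy, hyV⟩
  refine ⟨U ⊓ V, inf_le_left, hyT, ?_⟩
  obtain ⟨c, hc⟩ := (he (U ⊓ V) inf_le_right).2 (res M inf_le_left s)
  have he' := he.res (inf_le_right : U ⊓ V ≤ V)
  have h1 : toRat M hyT (res M inf_le_left s) = 0 := by rw [toRat_res M _ hx, hs]
  rw [← hc, toRat_sum_smul] at h1
  have h2 := Fintype.linearIndependent_iff.1 (he'.ratBasis hyT).linearIndependent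
    (fun i ↦ X.presheaf.germ _ (genericPoint X) (generic_mem hyT) (c i))
    (by simpa only [IsFrame.ratBasis_apply] using h1)
  have h3 : c = 0 := funext fun i ↦ germ_injective_of_isIntegral (X := X) _ (generic_mem hyT)
    ((h2 i).trans (map_zero _).symm)
  rw [← hc, h3]
  simp

lemma IsVectorBundle.finrank_rat {M : X.Modules} {n : ℕ} (hM : IsVectorBundle M n) :
    Module.finrank X.functionField (Rat M) = n := by
  obtain ⟨U, hU, e, he⟩ := hM (genericPoint X)
  simpa using Module.finrank_eq_card_basis (he.ratBasis hU)

lemma IsVectorBundle.finiteDimensional_rat {M : X.Modules} {n : ℕ} (hM : IsVectorBundle M n) :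
    FiniteDimensional X.functionField (Rat M) := by
  obtain ⟨U, hU, e, he⟩ := hM (genericPoint X)
  exact (he.ratBasis hU).finiteDimensional_of_finite

/-- Each of the finitely many frame sections is killed on some neighbourhood of the generic point,
so the homomorphism vanishes on a common one. -/
lemma IsVectorBundle.ratHom_injective {M N : X.Modules} {n : ℕ} (hM : IsVectorBundle M n) :
    Function.Injective (ratHom M N) := by
  rw [injective_iff_map_eq_zero]
  intro r hr
  obtain ⟨U, hU, e, he⟩ := hM (genericPoint X)
  obtain ⟨V, hVU, hV, (α : HomSec M N V), rfl⟩ := exists_toRat_le _ r hU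
  have h1 : ∀ i, ∃ (T : X.Opens) (h : T ≤ V), genericPoint X ∈ T ∧
      α.app T h (res M (h.trans hVU) (e i)) = 0 := fun i ↦ by
    have h2 := ratHom_toRat hV hV le_rfl α (res M hVU (e i))
    rw [hr, LinearMap.zero_apply, ← toRat_zero N hV] at h2
    obtain ⟨T, hT, _, hgT, h3⟩ := toRat_eq_iff _ _ _ _ _ h2.symm
    refine ⟨T, hT, hgT, ?_⟩
    rw [← res_res M hVU hT, α.app_res V T le_rfl hT]
    exact h3.trans (map_zero _)
  choose T hT hgT h using h1
  have hA : genericPoint X ∈ V ⊓ Finset.univ.inf T := ⟨hV, by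
    change _ ∈ ((Finset.univ.inf T : X.Opens) : Set X)
    rw [Opens.coe_finset_inf]; simpa using hgT⟩
  have h4 : HomSec.restrict (inf_le_left : V ⊓ Finset.univ.inf T ≤ V) α = 0 := by
    refine (he.res (inf_le_left.trans hVU : V ⊓ Finset.univ.inf T ≤ U)).homSec_ext fun i ↦ ?_
    have hi : V ⊓ Finset.univ.inf T ≤ T i := inf_le_right.trans (Finset.inf_le (Finset.mem_univ i))
    refine Eq.trans ?_ (LinearMap.zero_apply _).symm
    change α.app _ _ _ = _
    rw [← res_res M ((hT i).trans hVU) hi, α.app_res (T i) _ (hT i) hi, h i, map_zero]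
  refine (toRat_res (sheafHom M N) inf_le_left hV hA α).symm.trans ?_
  exact (congr_arg (toRat _ hA) h4).trans (toRat_zero _ _)

lemma ratHom_idSec (M : X.Modules) {x : X} (hx : x ∈ (⊤ : X.Opens)) (m : Rat M) :
    ratHom M M (toRat (sheafHom M M) hx (idSec M)) m = m := by
  obtain ⟨U, hU, s, rfl⟩ := exists_toRat _ m
  rw [ratHom_toRat hx hU le_top]
  rfl

end Rational

/-! ### Morphisms and rational sections -/

section Regular

variable {X : Scheme.{0}} [IsIntegral X] [X.Over SpecC]

lemma toRat_mem_regularAt (M : X.Modules) {x : X} {U : X.Opens} (hx : x ∈ U) (s : Γ(M, U)) :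
    toRat M hx s ∈ regularAt M x := ⟨U, hx, s, rfl⟩

lemma mem_regularAt_genericPoint (M : X.Modules) (r : Rat M) : r ∈ regularAt M (genericPoint X) :=
  exists_toRat M r

lemma exists_toRat_of_regular {M : X.Modules} {x : X} {r : Rat M} (hr : r ∈ regularAt M x)
    {U : X.Opens} (hx : x ∈ U) :
    ∃ (V : X.Opens) (_ : V ≤ U) (hV : x ∈ V) (s : Γ(M, V)), toRat M hV s = r := by
  obtain ⟨V, hV, s, rfl⟩ := hr
  exact ⟨V ⊓ U, inf_le_right, ⟨hV, hx⟩, res M inf_le_left s, toRat_res _ _ hV _ _⟩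

lemma smul_mem_regularAt {M : X.Modules} {x : X} (c : X.presheaf.stalk x) {r : Rat M}
    (hr : r ∈ regularAt M x) :
    algebraMap (X.presheaf.stalk x) X.functionField c • r ∈ regularAt M x := by
  obtain ⟨U, hU, s, rfl⟩ := hr
  obtain ⟨V, hVU, hV, f, hf⟩ := exists_germO_eq_le hU fun _ : Fin 1 ↦ c
  rw [← hf 0, algebraMap_germ, ← toRat_res M hVU hU hV, ← toRat_fsmul]
  exact toRat_mem_regularAt _ _ _

lemma IsFrame.exists_of_regular {M : X.Modules} {U : X.Opens} {n : ℕ} {e : Fin n → Γ(M, U)}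
    (he : IsFrame e) {x : X} (hx : x ∈ U) {r : Rat M} (hr : r ∈ regularAt M x) :
    ∃ c : Fin n → X.presheaf.stalk x,
      r = ∑ i, algebraMap (X.presheaf.stalk x) X.functionField (c i) • toRat M hx (e i) := by
  obtain ⟨V, hVU, hV, s, rfl⟩ := exists_toRat_of_regular hr hx
  obtain ⟨c, rfl⟩ := (he V hVU).2 s
  refine ⟨fun i ↦ X.presheaf.germ V x hV (c i), ?_⟩
  simp only [toRat_sum_smul, algebraMap_germ, toRat_res M hVU hx hV]

lemma sum_mem_regularAt {M : X.Modules} {x : X} {ι : Type*} (S : Finset ι)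
    (c : ι → X.presheaf.stalk x) (r : ι → Rat M) (hr : ∀ i ∈ S, r i ∈ regularAt M x) :
    ∑ i ∈ S, algebraMap (X.presheaf.stalk x) X.functionField (c i) • r i ∈ regularAt M x :=
  sum_mem fun i hi ↦ smul_mem_regularAt _ (hr i hi)

lemma ratHom_mem {M N : X.Modules} {x : X} {r : Rat (sheafHom M N)} {m : Rat M}
    (hr : r ∈ regularAt (sheafHom M N) x) (hm : m ∈ regularAt M x) :
    ratHom M N r m ∈ regularAt N x := by
  obtain ⟨U, hU, a, rfl⟩ := hr
  obtain ⟨V, hVU, hV, s, rfl⟩ := exists_toRat_of_regular hm hU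
  rw [ratHom_toRat hU hV hVU]
  exact toRat_mem_regularAt _ _ _

lemma exists_common_sections {M : X.Modules} {x : X} {U : X.Opens} (hx : x ∈ U) {ι : Type}
    [Finite ι] (r : ι → Rat M) (hr : ∀ i, r i ∈ regularAt M x) :
    ∃ (V : X.Opens) (_ : V ≤ U) (hV : x ∈ V) (s : ι → Γ(M, V)), ∀ i, toRat M hV (s i) = r i := by
  choose T hT t ht using hr
  obtain ⟨V, hVU, hV, s, hs⟩ :=
    exists_germ_eq_le M hx fun i ↦ M.presheaf.germ (T i) x (hT i) (t i)
  refine ⟨V, hVU, hV, s, fun i ↦ ?_⟩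
  obtain ⟨A, hA, hA', hxA, h⟩ := exists_res_eq M _ _ _ _ (hs i)
  rw [← ht, ← toRat_res M hA hV hxA, h, toRat_res]

lemma IsFrame.exists_ratHom_eq {M N : X.Modules} {U : X.Opens} {n : ℕ} {e : Fin n → Γ(M, U)}
    (he : IsFrame e) {x : X} (hx : x ∈ U) (f : Rat M →ₗ[X.functionField] Rat N)
    (hf : ∀ i, f (toRat M hx (e i)) ∈ regularAt N x) :
    ∃ r ∈ regularAt (sheafHom M N) x, ratHom M N r = f := by
  obtain ⟨V, hVU, hV, t, ht⟩ := exists_common_sections hx _ hf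
  refine ⟨_, toRat_mem_regularAt (sheafHom M N) hV ((he.res hVU).constr t), ?_⟩
  refine ((he.res hVU).ratBasis hV).ext fun i ↦ ?_
  rw [IsFrame.ratBasis_apply]
  refine (ratHom_toRat hV hV le_rfl ((he.res hVU).constr t) _).trans ?_
  refine (congr_arg (toRat N hV) ((he.res hVU).constr_app t i)).trans ?_
  rw [ht, toRat_res]

/-- This allows `Hom` sheaves to be replaced by `K`-linear maps throughout. The images of a frame,
being regular at `x`, extend to a common neighbourhood and define a homomorphism there. -/
lemma IsVectorBundle.mem_regularAt_sheafHom_iff {M N : X.Modules} {n : ℕ}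
    (hM : IsVectorBundle M n) {x : X} {r : Rat (sheafHom M N)} :
    r ∈ regularAt (sheafHom M N) x ↔
      ∀ m ∈ regularAt M x, ratHom M N r m ∈ regularAt N x := by
  refine ⟨fun hr m hm ↦ ratHom_mem hr hm, fun h ↦ ?_⟩
  obtain ⟨U, hU, e, he⟩ := hM x
  obtain ⟨q, hq, hqr⟩ := he.exists_ratHom_eq hU (ratHom M N r)
    fun i ↦ h _ (toRat_mem_regularAt _ _ _)
  rwa [← hM.ratHom_injective hqr]

/-- For a vector bundle `M`, rational sections of `Hom(M, N)` are the `K`-linear maps between the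
spaces of rational sections. -/
def IsVectorBundle.ratHomEquiv {M : X.Modules} {n : ℕ} (hM : IsVectorBundle M n)
    (N : X.Modules) :
    Rat (sheafHom M N) ≃ₗ[X.functionField] (Rat M →ₗ[X.functionField] Rat N) :=
  LinearEquiv.ofBijective (ratHom M N) ⟨hM.ratHom_injective, fun f ↦ by
    obtain ⟨U, hU, e, he⟩ := hM (genericPoint X)
    obtain ⟨r, _, hr⟩ := he.exists_ratHom_eq hU f fun i ↦ mem_regularAt_genericPoint _ _
    exact ⟨r, hr⟩⟩

lemma IsVectorBundle.ratHom_symm {M N : X.Modules} {n : ℕ} (hM : IsVectorBundle M n)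
    (f : Rat M →ₗ[X.functionField] Rat N) : ratHom M N ((hM.ratHomEquiv N).symm f) = f :=
  (hM.ratHomEquiv N).apply_symm_apply f

lemma IsVectorBundle.symm_mem_regularAt_iff {M N : X.Modules} {n : ℕ} (hM : IsVectorBundle M n)
    {x : X} (f : Rat M →ₗ[X.functionField] Rat N) :
    (hM.ratHomEquiv N).symm f ∈ regularAt (sheafHom M N) x ↔
      ∀ m ∈ regularAt M x, f m ∈ regularAt N x := by
  rw [hM.mem_regularAt_sheafHom_iff, hM.ratHom_symm]

/-- `ratMap` as a `K`-linear map. -/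
def ratMapK {M N : X.Modules} (f : M ⟶ N) : Rat M →ₗ[X.functionField] Rat N where
  toFun := ratMap f
  map_add' := map_add (ratMap f)
  map_smul' c r := by
    obtain ⟨V, _, hV, a, s, rfl, rfl, h⟩ := exists_toRat_smul M c r
      (Opens.mem_top (genericPoint X))
    rw [← h, ratMap_toRat, ratMap_toRat, Scheme.Modules.Hom.app_smul, toRat_fsmul]
    rfl

lemma ratMap_eq_ratMapK {M N : X.Modules} (f : M ⟶ N) (r : Rat M) : ratMap f r = ratMapK f r := rfl

lemma ratMapK_toRat {M N : X.Modules} (f : M ⟶ N) {x : X} {U : X.Opens} (hx : x ∈ U)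
    (s : Γ(M, U)) : ratMapK f (toRat M hx s) = toRat N hx (f.app U s) :=
  ratMap_toRat f hx s

lemma ratMapK_regular {M N : X.Modules} (f : M ⟶ N) {x : X} {r : Rat M} (hr : r ∈ regularAt M x) :
    ratMapK f r ∈ regularAt N x := ratMap_regular f hr

lemma ratMapK_comp {M N P : X.Modules} (f : M ⟶ N) (g : N ⟶ P) (r : Rat M) :
    ratMapK (f ≫ g) r = ratMapK g (ratMapK f r) := by
  obtain ⟨U, hU, s, rfl⟩ := exists_toRat M r
  simp only [ratMapK_toRat]
  rfl

lemma ratMapK_id (M : X.Modules) (r : Rat M) : ratMapK (𝟙 M) r = r := by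
  obtain ⟨U, hU, s, rfl⟩ := exists_toRat M r
  simp only [ratMapK_toRat]
  rfl

lemma ratHom_postcomp (M : X.Modules) {N N' : X.Modules} (f : N ⟶ N') (r : Rat (sheafHom M N))
    (m : Rat M) :
    ratHom M N' (ratMapK (postcomp M f) r) m = ratMapK f (ratHom M N r m) := by
  obtain ⟨U, hU, a, s, rfl, rfl⟩ := exists_toRat₂ _ _ r m
  rw [ratMapK_toRat, ratHom_toRat hU hU le_rfl, ratHom_toRat hU hU le_rfl, ratMapK_toRat]
  rfl

lemma ratHom_precomp {M M' : X.Modules} (f : M ⟶ M') (N : X.Modules) (r : Rat (sheafHom M' N))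
    (m : Rat M) :
    ratHom M N (ratMapK (precomp f N) r) m = ratHom M' N r (ratMapK f m) := by
  obtain ⟨U, hU, a, s, rfl, rfl⟩ := exists_toRat₂ _ _ r m
  rw [ratMapK_toRat, ratMapK_toRat, ratHom_toRat hU hU le_rfl, ratHom_toRat hU hU le_rfl]
  rfl

lemma IsTorsionFree.exists_section {M : X.Modules} (hM : IsTorsionFree M) (U : X.Opens)
    (r : Rat M) (hr : ∀ x ∈ U, r ∈ regularAt M x) :
    ∃ s : Γ(M, U), ∀ (x : X) (hx : x ∈ U), toRat M hx s = r := by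
  choose V hVU hV s hs using fun x : U ↦ exists_toRat_of_regular (hr x.1 x.2) x.2
  obtain ⟨t, ht⟩ := exists_glue M V U hVU
    (fun x hx ↦ Opens.mem_iSup.2 ⟨(⟨x, hx⟩ : U), hV ⟨x, hx⟩⟩) s fun i j ↦ hM.eq fun x hx ↦ by
      rw [toRat_res M _ (hV i), toRat_res M _ (hV j), hs, hs]
  refine ⟨t, fun x hx ↦ ?_⟩
  rw [← toRat_res M (hVU ⟨x, hx⟩) hx (hV ⟨x, hx⟩), ht, hs]

lemma csmul_eq (M : X.Modules) (c : ℂ) (r : Rat M) :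
    c • r = (constStalk X (genericPoint X) c : X.functionField) • r := rfl

lemma algebraMap_constStalk (x : X) (c : ℂ) :
    algebraMap (X.presheaf.stalk x) X.functionField (constStalk X x c) =
      constStalk X (genericPoint X) c :=
  algebraMap_germ (Opens.mem_top x) _

end Regular

/-! ### Values -/

lemma _root_.Module.Basis.mem_ideal_smul_top_iff {R E ι : Type*} [CommRing R] [AddCommGroup E]
    [Module R E] [Fintype ι] (b : Module.Basis ι R E) (I : Ideal R) (v : E) :
    v ∈ I • (⊤ : Submodule R E) ↔ ∀ i, b.repr v i ∈ I := by
  refine ⟨fun h i ↦ ?_, fun h ↦ ?_⟩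
  · induction h using Submodule.smul_induction_on' with
    | smul r hr m _ => simpa using I.mul_mem_right _ hr
    | add x _ y _ hx hy => simpa using I.add_mem hx hy
  · rw [← b.sum_repr v]
    exact sum_mem fun i _ ↦ Submodule.smul_mem_smul (h i) trivial

section Values

variable {X : Scheme.{0}} {M : X.Modules} {U : X.Opens} {n : ℕ} {e : Fin n → Γ(M, U)}

lemma value_add (M : X.Modules) {x : X} (hx : x ∈ U) (s t : Γ(M, U)) :
    value M hx (s + t) = value M hx s + value M hx t := by
  unfold value
  rw [map_add]
  rfl

lemma value_smul (M : X.Modules) {x : X} (hx : x ∈ U) (f : Γ(X, U)) (s : Γ(M, U)) :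
    value M hx (f • s) = X.presheaf.germ U x hx f • value M hx s := by
  unfold value
  rw [germ_smul]
  rfl

lemma value_res (M : X.Modules) {x : X} {V : X.Opens} (h : V ≤ U) (hx : x ∈ V) (s : Γ(M, U)) :
    value M hx (res M h s) = value M (h hx) s := by
  unfold value
  rw [germ_res]

lemma value_eq_zero_iff (M : X.Modules) {x : X} (hx : x ∈ U) (s : Γ(M, U)) :
    value M hx s = 0 ↔ M.presheaf.germ U x hx s ∈
      (IsLocalRing.maximalIdeal (X.presheaf.stalk x) •
        (⊤ : Submodule (X.presheaf.stalk x) (M.presheaf.stalk x))) :=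
  Submodule.Quotient.mk_eq_zero _

lemma IsFrame.value_eq_zero_iff (he : IsFrame e) {x : X} (hx : x ∈ U) (c : Fin n → Γ(X, U)) :
    value M hx (∑ i, c i • e i) = 0 ↔
      ∀ i, X.presheaf.germ U x hx (c i) ∈ IsLocalRing.maximalIdeal (X.presheaf.stalk x) := by
  rw [LagLift.value_eq_zero_iff, germ_sum_smul]
  simp only [← he.stalkBasis_apply hx]
  rw [(he.stalkBasis hx).mem_ideal_smul_top_iff, Module.Basis.repr_sum_self]

end Values

/-! ### The bundle `Hom(F, L)` -/

section Dual

variable {X : Scheme.{0}}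

lemma IsVectorBundle.exists_frame_le {M : X.Modules} {n : ℕ} (hM : IsVectorBundle M n) {x : X}
    {U : X.Opens} (hx : x ∈ U) :
    ∃ (V : X.Opens) (_ : V ≤ U) (_ : x ∈ V) (e : Fin n → Γ(M, V)), IsFrame e := by
  obtain ⟨V, hV, e, he⟩ := hM x
  exact ⟨V ⊓ U, inf_le_right, ⟨hV, hx⟩, _, he.res inf_le_left⟩

lemma IsVectorBundle.exists_frames {M N : X.Modules} {m n : ℕ} (hM : IsVectorBundle M m)
    (hN : IsVectorBundle N n) (x : X) :
    ∃ (V : X.Opens) (_ : x ∈ V) (e : Fin m → Γ(M, V)) (l : Fin n → Γ(N, V)),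
      IsFrame e ∧ IsFrame l := by
  obtain ⟨U, hU, e, he⟩ := hM x
  obtain ⟨V, hVU, hV, l, hl⟩ := hN.exists_frame_le hU
  exact ⟨V, hV, _, l, he.res hVU, hl⟩

lemma IsVectorBundle.sheafHom {F L : X.Modules} {n : ℕ} (hF : IsVectorBundle F n)
    (hL : IsVectorBundle L 1) : IsVectorBundle (sheafHom F L) n := by
  intro x
  obtain ⟨U, hU, e, l, he, hl⟩ := hF.exists_frames hL x
  -- The dual frame: `φ a` sends `e a` to the generator `l 0` and the other frame sections to zero,
  -- so evaluation at `e b` reads off the coefficient of `φ b`.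
  let φ (a : Fin n) : HomSec F L U := he.constr (Pi.single a (l 0))
  refine ⟨U, hU, φ, fun V hV ↦ ?_⟩
  have key (c : Fin n → Γ(X, V)) (b : Fin n) : (∑ a, c a • HomSec.restrict hV (φ a)).app V le_rfl
      (res F hV (e b)) = c b • res L hV (l 0) := by
    have h1 : ∀ S : Finset (Fin n), (∑ a ∈ S, c a • HomSec.restrict hV (φ a)).app V le_rfl
        (res F hV (e b)) = ∑ a ∈ S, (c a • HomSec.restrict hV (φ a)).app V le_rfl
          (res F hV (e b)) := fun S ↦
      map_sum (AddMonoidHom.mk' (fun α : HomSec F L V ↦ α.app V le_rfl (res F hV (e b)))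
        fun _ _ ↦ rfl) _ _
    rw [h1, Finset.sum_eq_single b]
    · refine (congr_arg (resO X le_rfl (c b) • ·) ((φ b).app_res U V le_rfl hV (e b))).trans ?_
      simp only [resO_self, φ, he.constr_app, Pi.single_eq_same]
    · intro a _ hab
      refine (congr_arg (resO X le_rfl (c a) • ·) ((φ a).app_res U V le_rfl hV (e b))).trans ?_
      simp only [φ, he.constr_app, Pi.single_eq_of_ne hab.symm, map_zero, smul_zero]
    · simp
  have hinj := fun c d : Γ(X, V) ↦ @(hl V hV).1 (fun _ ↦ c) (fun _ ↦ d)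
  constructor
  · intro c d hcd
    funext b
    have h2 := (key c b).symm.trans ((congr_arg (fun α : HomSec F L V ↦ α.app V le_rfl
      (res F hV (e b))) hcd).trans (key d b))
    exact congr_fun (hinj _ _ (by simpa using h2)) 0
  · intro (α : HomSec F L V)
    choose c hc using fun b ↦ (hl V hV).2 (α.app V le_rfl (res F hV (e b)))
    refine ⟨fun b ↦ c b 0, (he.res hV).homSec_ext fun b ↦ (key _ b).trans ?_⟩
    rw [← hc b]
    simp

end Dual

/-! ### Retractions of subbundles -/

/-- A form of Nakayama's lemma: the hypothesis says that the rows of `A` are independent over the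
residue field. A right inverse there lifts to `B` with `det (A * B)` congruent to `1`, hence a unit,
and `B * (A * B)⁻¹` is an exact right inverse. -/
lemma exists_mul_eq_one_of_residue {R : Type*} [CommRing R] [IsLocalRing R] {n m : ℕ}
    (A : Matrix (Fin n) (Fin m) R)
    (hA : ∀ c : Fin n → R, (∀ b, Matrix.vecMul c A b ∈ IsLocalRing.maximalIdeal R) →
      ∀ a, c a ∈ IsLocalRing.maximalIdeal R) :
    ∃ B : Matrix (Fin m) (Fin n) R, A * B = 1 := by
  let q := IsLocalRing.residue R
  have hinj : LinearMap.ker (Matrix.vecMulLinear (A.map q)) = ⊥ := by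
    rw [LinearMap.ker_eq_bot']
    intro c hc
    choose d hd using fun a ↦ IsLocalRing.residue_surjective (c a)
    obtain rfl : (fun a ↦ q (d a)) = c := funext hd
    funext a
    refine (IsLocalRing.residue_eq_zero_iff _).2 (hA d (fun b ↦ ?_) a)
    rw [← IsLocalRing.residue_eq_zero_iff]
    have := congr_fun hc b
    simpa [Matrix.vecMul, dotProduct] using this
  obtain ⟨g, hg⟩ := LinearMap.exists_leftInverse_of_injective _ hinj
  choose B hB using fun b a ↦ IsLocalRing.residue_surjective (g (Pi.single b 1) a)
  have h1 : (A * Matrix.of B).map q = 1 := by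
    ext a a'
    have h2 := congr_fun (LinearMap.congr_fun hg (Pi.single a 1)) a'
    simp only [LinearMap.comp_apply, Matrix.vecMulLinear_apply, Matrix.single_one_vecMul,
      LinearMap.id_apply] at h2
    have h3 : (A.map q).row a = ∑ b, q (A a b) • Pi.single b 1 := by
      ext b
      simp [Pi.single_apply]
    rw [h3, map_sum] at h2
    simp only [map_smul, Finset.sum_apply, Pi.smul_apply, smul_eq_mul, ← hB] at h2
    rw [Matrix.map_apply, Matrix.mul_apply, Matrix.one_apply, map_sum]
    simp only [map_mul, Matrix.of_apply]
    exact h2.trans (by simp [Pi.single_apply, eq_comm])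
  have h4 : IsUnit (A * Matrix.of B).det := by
    by_contra h
    have h5 := (IsLocalRing.residue_eq_zero_iff _).2 ((IsLocalRing.mem_maximalIdeal _).2 h)
    rw [show IsLocalRing.residue R (A * Matrix.of B).det = ((A * Matrix.of B).map q).det from
      RingHom.map_det q _, h1, Matrix.det_one] at h5
    exact one_ne_zero h5
  exact ⟨Matrix.of B * (A * Matrix.of B)⁻¹, by
    rw [← Matrix.mul_assoc, Matrix.mul_nonsing_inv _ h4]⟩

section Retraction

variable {X : Scheme.{0}} [IsIntegral X] [X.Over SpecC] {F W : X.Modules} {n m : ℕ}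

/-- In local frames `i` is a matrix over the local ring. Injectivity on the fibre is the hypothesis
of `exists_mul_eq_one_of_residue`, and the right inverse is the matrix of `ρ`. -/
lemma exists_retraction (hF : IsVectorBundle F n) (hW : IsVectorBundle W m) (i : F ⟶ W)
    (hi : IsSubbundle i) (x : X) :
    ∃ ρ : Rat W →ₗ[X.functionField] Rat F, (∀ f, ρ (ratMapK i f) = f) ∧
      ∀ w ∈ regularAt W x, ρ w ∈ regularAt F x := by
  obtain ⟨U, hU, e, w, he, hw⟩ := hF.exists_frames hW x
  choose A hA using fun a ↦ (hw U le_rfl).2 (i.app U (e a))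
  simp only [res_self] at hA
  obtain ⟨B, hB⟩ := exists_mul_eq_one_of_residue
    (Matrix.of fun a b ↦ X.presheaf.germ U x hU (A a b)) fun c hc ↦ by
    obtain ⟨V, hVU, hV, f, hf⟩ := exists_germO_eq_le hU c
    obtain rfl : (fun a ↦ X.presheaf.germ V x hV (f a)) = c := funext hf
    refine ((he.res hVU).value_eq_zero_iff hV f).1 (hi x V hV _ ?_)
    have h1 : i.app V (∑ a, f a • res F hVU (e a)) =
        ∑ b, (∑ a, f a * resO X hVU (A a b)) • res W hVU (w b) := by
      simp only [map_sum, Scheme.Modules.Hom.app_smul, app_res, ← hA, res_smul, Finset.sum_smul,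
        mul_smul, Finset.smul_sum]
      exact Finset.sum_comm
    rw [h1, (hw.res hVU).value_eq_zero_iff hV]
    intro b
    refine (congr_arg (· ∈ IsLocalRing.maximalIdeal (X.presheaf.stalk x)) ?_).mpr (hc b)
    simp [Matrix.vecMul, dotProduct, germ_resO]
  let ι := algebraMap (X.presheaf.stalk x) X.functionField
  let ρ := (hw.ratBasis hU).constr X.functionField fun b ↦ ∑ a, ι (B b a) • toRat F hU (e a)
  have hρ : ∀ b, ρ (toRat W hU (w b)) = ∑ a, ι (B b a) • toRat F hU (e a) := fun b ↦ by
    rw [← hw.ratBasis_apply hU, Module.Basis.constr_basis]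
  refine ⟨ρ, ?_, fun r hr ↦ ?_⟩
  · intro f
    refine LinearMap.congr_fun (f := ρ ∘ₗ ratMapK i) (g := LinearMap.id)
      ((he.ratBasis hU).ext fun a ↦ ?_) f
    rw [he.ratBasis_apply, LinearMap.comp_apply, ratMapK_toRat, ← hA, toRat_sum_smul, map_sum]
    simp only [map_smul, hρ, ← algebraMap_germ hU, Finset.smul_sum, smul_smul]
    rw [Finset.sum_comm]
    have h2 : ∀ a', ∑ b, ι (X.presheaf.germ U x hU (A a b)) * ι (B b a') =
        if a = a' then 1 else 0 := fun a' ↦ by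
      have := congr_arg ι (congr_fun (congr_fun hB a) a')
      rw [Matrix.mul_apply, Matrix.one_apply, map_sum] at this
      simp only [map_mul, Matrix.of_apply] at this
      rw [this]
      split_ifs <;> simp
    simp only [← Finset.sum_smul]
    simp only [ι] at h2
    simp [ι, h2]
  · obtain ⟨c, rfl⟩ := hw.exists_of_regular hU hr
    rw [map_sum]
    simp only [map_smul, hρ]
    exact sum_mem_regularAt _ _ _ fun b _ ↦ sum_mem_regularAt _ _ _ fun a _ ↦
      toRat_mem_regularAt _ _ _

end Retraction

section

variable {X : Scheme.{0}} [IsIntegral X] [X.Over SpecC]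

/-! ### Regular maps and duality -/

/-- The `K`-linear map `f` maps sections regular at `x` to sections regular at `x`. -/
def IsRegularMap {M N : X.Modules} (f : Rat M →ₗ[X.functionField] Rat N) (x : X) : Prop :=
  ∀ m ∈ regularAt M x, f m ∈ regularAt N x

section Duality

variable {F L : X.Modules} {n : ℕ}

omit [X.Over SpecC] in
lemma IsFrame.toRat_ne_zero {U : X.Opens} {l : Fin 1 → Γ(L, U)} (hl : IsFrame l) {x : X}
    (hx : x ∈ U) : toRat L hx (l 0) ≠ 0 := by
  rw [← hl.ratBasis_apply]
  exact (hl.ratBasis hx).ne_zero 0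

lemma IsFrame.exists_dual {U : X.Opens} {e : Fin n → Γ(F, U)} (he : IsFrame e) {x : X}
    (hx : x ∈ U) (l : Γ(L, U)) (a : Fin n) : ∃ φ ∈ regularAt (sheafHom F L) x,
      ∀ b, ratHom F L φ (toRat F hx (e b)) = if b = a then toRat L hx l else 0 := by
  obtain ⟨φ, hφ, h⟩ := he.exists_ratHom_eq hx
    ((he.ratBasis hx).constr X.functionField fun b ↦ if b = a then toRat L hx l else 0)
    fun b ↦ by
      rw [← he.ratBasis_apply, Module.Basis.constr_basis]
      split_ifs
      · exact toRat_mem_regularAt _ _ _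
      · exact zero_mem _
  exact ⟨φ, hφ, fun b ↦ by rw [h, ← he.ratBasis_apply, Module.Basis.constr_basis]⟩

lemma IsFrame.exists_of_smul_mem {U : X.Opens} {l : Fin 1 → Γ(L, U)} (hl : IsFrame l) {x : X}
    (hx : x ∈ U) {c : X.functionField} (hc : c • toRat L hx (l 0) ∈ regularAt L x) :
    ∃ d, algebraMap (X.presheaf.stalk x) X.functionField d = c := by
  obtain ⟨d, hd⟩ := hl.exists_of_regular hx hc
  refine ⟨d 0, smul_left_injective _ (hl.toRat_ne_zero hx) ?_⟩
  simpa using hd.symm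

/-- The dual frame reads off the coefficients of `f`. -/
lemma mem_regularAt_of_dual (hF : IsVectorBundle F n) (hL : IsVectorBundle L 1) {x : X}
    {f : Rat F} (hf : ∀ φ ∈ regularAt (sheafHom F L) x, ratHom F L φ f ∈ regularAt L x) :
    f ∈ regularAt F x := by
  obtain ⟨U, hU, e, l, he, hl⟩ := hF.exists_frames hL x
  rw [← (he.ratBasis hU).sum_repr f]
  refine sum_mem fun a _ ↦ ?_
  obtain ⟨φ, hφ, h⟩ := he.exists_dual hU (l 0) a
  have h1 := hf φ hφ
  rw [← (he.ratBasis hU).sum_repr f, map_sum] at h1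
  simp only [map_smul, he.ratBasis_apply, h, smul_ite, smul_zero, Finset.sum_ite_eq',
    Finset.mem_univ, if_true] at h1
  obtain ⟨d, hd⟩ := hl.exists_of_smul_mem hU h1
  rw [← hd, he.ratBasis_apply]
  exact smul_mem_regularAt _ (toRat_mem_regularAt _ _ _)

lemma eq_zero_of_dual (hF : IsVectorBundle F n) (hL : IsVectorBundle L 1) {f : Rat F}
    (hf : ∀ φ, ratHom F L φ f = 0) : f = 0 := by
  obtain ⟨U, hU, e, l, he, hl⟩ := hF.exists_frames hL (genericPoint X)
  rw [← (he.ratBasis hU).sum_repr f]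
  refine Finset.sum_eq_zero fun a _ ↦ ?_
  obtain ⟨φ, hφ, h⟩ := he.exists_dual hU (l 0) a
  have h1 := hf φ
  rw [← (he.ratBasis hU).sum_repr f, map_sum] at h1
  simp only [map_smul, he.ratBasis_apply, h, smul_ite, smul_zero, Finset.sum_ite_eq',
    Finset.mem_univ, if_true] at h1
  rw [(smul_eq_zero.1 h1).resolve_right (hl.toRat_ne_zero hU), zero_smul]

omit [X.Over SpecC] in
lemma finrank_ratLin {M N : X.Modules} {m k : ℕ} (hM : IsVectorBundle M m)
    (hN : IsVectorBundle N k) :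
    Module.finrank X.functionField (Rat M →ₗ[X.functionField] Rat N) = m * k := by
  have := hM.finiteDimensional_rat
  have := hN.finiteDimensional_rat
  rw [Module.finrank_linearMap, hM.finrank_rat, hN.finrank_rat]

/-- The transpose of a map `β : F* ⊗ L → F`. -/
lemma exists_transpose (hF : IsVectorBundle F n) (hL : IsVectorBundle L 1)
    (β : Rat (sheafHom F L) →ₗ[X.functionField] Rat F) :
    ∃ β' : Rat (sheafHom F L) →ₗ[X.functionField] Rat F,
      ∀ φ ψ, ratHom F L ψ (β' φ) = ratHom F L φ (β ψ) := by
  have := hF.finiteDimensional_rat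
  have := hL.finiteDimensional_rat
  have := (hF.sheafHom hL).finiteDimensional_rat
  have hinj : Function.Injective (ratHom F L).flip := by
    rw [injective_iff_map_eq_zero]
    exact fun f hf ↦ eq_zero_of_dual hF hL fun φ ↦ LinearMap.congr_fun hf φ
  -- Biduality: evaluation embeds `Rat F` in the `K`-linear maps `Rat (Hom(F, L)) → Rat L`, and both
  -- spaces have dimension `n`.
  let T := LinearEquiv.ofInjectiveOfFinrankEq (ratHom F L).flip hinj (by
    rw [finrank_ratLin (hF.sheafHom hL) hL, hF.finrank_rat, mul_one])
  refine ⟨T.symm.toLinearMap ∘ₗ LinearMap.lcomp _ _ β ∘ₗ ratHom F L, fun φ ψ ↦ ?_⟩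
  exact LinearMap.congr_fun (T.apply_symm_apply (ratHom F L φ ∘ₗ β)) ψ

/-- The map `p : F* ⊗ L → F` is symmetric. -/
def IsSymmetricMap (p : Rat (sheafHom F L) →ₗ[X.functionField] Rat F) : Prop :=
  ∀ φ ψ, ratHom F L ψ (p φ) = ratHom F L φ (p ψ)

/-- A map that becomes regular at `x` after adding symmetric maps becomes so after symmetrization. -/
lemma exists_symmetrization (hF : IsVectorBundle F n) (hL : IsVectorBundle L 1)
    (β : Rat (sheafHom F L) →ₗ[X.functionField] Rat F) :
    ∃ β' : Rat (sheafHom F L) →ₗ[X.functionField] Rat F, IsSymmetricMap β' ∧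
      ∀ x p, IsSymmetricMap p → IsRegularMap (p - β) x → IsRegularMap (p - β') x := by
  obtain ⟨b, hb⟩ := exists_transpose hF hL β
  -- The symmetrization `(β + b) / 2`, where `b` is the transpose. The factor is a complex constant,
  -- so it preserves regularity.
  refine ⟨(constStalk X (genericPoint X) 2⁻¹ : X.functionField) • (β + b), fun φ ψ ↦ ?_,
    fun x p hp h φ hφ ↦ ?_⟩
  · simp only [LinearMap.smul_apply, LinearMap.add_apply, map_smul, map_add, hb, add_comm]
  -- As `p` is symmetric, `p - b` is the transpose of `p - β`, so it is regular by duality. The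
  -- average of the two is `p - β'`.
  have h1 : (p - b) φ ∈ regularAt F x := mem_regularAt_of_dual hF hL fun ψ hψ ↦ by
    have := ratHom_mem hφ (h ψ hψ)
    rwa [LinearMap.sub_apply, map_sub, ← hb, ← hp, ← map_sub] at this
  have h2 := (regularAt F x).smul_mem (2⁻¹ : ℂ) (add_mem (h φ hφ) h1)
  rw [csmul_eq] at h2
  refine (congr_arg (· ∈ regularAt F x) ?_).mpr h2
  have h3 : (constStalk X (genericPoint X) 2⁻¹ : X.functionField) • ((p φ + p φ : Rat F)) = p φ := by
    rw [← two_smul X.functionField, smul_smul,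
      show (2 : X.functionField) = constStalk X (genericPoint X) 2 from
        (map_ofNat (constStalk X (genericPoint X)) 2).symm]
    rw [← map_mul, inv_mul_cancel₀ two_ne_zero, map_one, one_smul]
  simp only [LinearMap.sub_apply, LinearMap.smul_apply, LinearMap.add_apply]
  nth_rw 1 [← h3]
  rw [← smul_sub]
  congr 1
  abel

end Duality

/-! ### Symmetric rational sections -/

section Symm

variable {F L : X.Modules} {n : ℕ}

lemma symHomι_injective (F L : X.Modules) : Function.Injective (ratMapK (symHomι F L)) := by
  rw [injective_iff_map_eq_zero]
  intro r hr
  obtain ⟨U, hU, a, rfl⟩ := exists_toRat _ r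
  rw [ratMapK_toRat, ← toRat_zero _ hU] at hr
  obtain ⟨T, hT, _, hgT, h⟩ := toRat_eq_iff _ _ _ _ _ hr
  rw [← toRat_res _ hT hU hgT]
  refine (congr_arg (toRat _ hgT) (Subtype.ext ?_)).trans (toRat_zero _ hgT)
  exact h.trans (map_zero _)

omit [X.Over SpecC] in
lemma isSymm_of_rat (hL : IsTorsionFree L) {U : X.Opens} {x : X} (hx : x ∈ U)
    (α : Γ(sheafHom (sheafHom F L) F, U))
    (h : IsSymmetricMap (ratHom (sheafHom F L) F (toRat _ hx α))) :
    IsSymm (F := F) (L := L) (U := U) α := by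
  suffices key : ∀ (V : X.Opens) (hV : V ≤ U) (φ ψ : Γ(sheafHom F L, V)),
      ev ψ (HomSec.app α V hV φ) = ev φ (HomSec.app α V hV ψ) from key
  intro V hV φ ψ
  refine hL.eq fun y hy ↦ ?_
  have h1 := h (toRat (sheafHom F L) hy φ) (toRat (sheafHom F L) hy ψ)
  rw [ratHom_toRat hx hy hV, ratHom_toRat hx hy hV, ratHom_toRat hy hy le_rfl,
    ratHom_toRat hy hy le_rfl] at h1
  exact h1

lemma isSymmetricMap_ratMapK (r : Rat (symHom F L)) :
    IsSymmetricMap (ratHom (sheafHom F L) F (ratMapK (symHomι F L) r)) := by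
  intro φ ψ
  obtain ⟨U, hU, a, f, g, rfl, rfl, rfl⟩ := exists_toRat₃ _ _ _ r φ ψ
  rw [ratMapK_toRat, ratHom_toRat hU hU le_rfl, ratHom_toRat hU hU le_rfl,
    ratHom_toRat hU hU le_rfl, ratHom_toRat hU hU le_rfl]
  exact congr_arg (toRat L hU) (a.2 U le_rfl f g)

/-- A symmetric section of `Hom(F* ⊗ L, F)` as a section of `L⁻¹ ⊗ Sym² F`. -/
def symSec {U : X.Opens} (α : Γ(sheafHom (sheafHom F L) F, U))
    (h : IsSymm (F := F) (L := L) (U := U) α) : Γ(symHom F L, U) :=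
  (⟨α, h⟩ : (symSub F L).obj (op U))

omit [IsIntegral X] [X.Over SpecC] in
lemma symHomι_symSec {U : X.Opens} (α : Γ(sheafHom (sheafHom F L) F, U))
    (h : IsSymm (F := F) (L := L) (U := U) α) : (symHomι F L).app U (symSec α h) = α := rfl

/-- Symmetry can be tested on rational sections since `L` is torsion free. Hence a regular section
of the ambient sheaf that represents `r` is itself symmetric. -/
lemma symHom_mem_regularAt_iff (hL : IsTorsionFree L) {x : X} {r : Rat (symHom F L)} :
    r ∈ regularAt (symHom F L) x ↔
      ratMapK (symHomι F L) r ∈ regularAt (sheafHom (sheafHom F L) F) x := by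
  refine ⟨ratMapK_regular _, fun ⟨U, hU, α, h⟩ ↦ ?_⟩
  have hs : IsSymm (F := F) (L := L) (U := U) α := isSymm_of_rat hL hU α (by
    rw [h]; exact isSymmetricMap_ratMapK r)
  refine ⟨U, hU, symSec α hs, symHomι_injective F L ?_⟩
  rw [ratMapK_toRat, symHomι_symSec, h]

lemma exists_symHom (hF : IsVectorBundle F n) (hL : IsVectorBundle L 1)
    {p : Rat (sheafHom F L) →ₗ[X.functionField] Rat F} (hp : IsSymmetricMap p) :
    ∃ r : Rat (symHom F L), ratHom (sheafHom F L) F (ratMapK (symHomι F L) r) = p := by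
  obtain ⟨q, rfl⟩ := ((hF.sheafHom hL).ratHomEquiv F).surjective p
  obtain ⟨U, hU, α, rfl⟩ := exists_toRat _ q
  have hs : IsSymm (F := F) (L := L) (U := U) α := isSymm_of_rat hL.isTorsionFree hU α hp
  refine ⟨toRat _ hU (symSec α hs), ?_⟩
  rw [ratMapK_toRat, symHomι_symSec]
  rfl

/-- The map `F* ⊗ L → F` defined by a rational section of `L⁻¹ ⊗ Sym² F`. -/
def symMap (F L : X.Modules) :
    Rat (symHom F L) →ₗ[X.functionField] Rat (sheafHom F L) →ₗ[X.functionField] Rat F :=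
  ratHom (sheafHom F L) F ∘ₗ ratMapK (symHomι F L)

lemma symMap_apply (r : Rat (symHom F L)) :
    symMap F L r = ratHom (sheafHom F L) F (ratMapK (symHomι F L) r) := rfl

lemma symHom_regular_iff (hF : IsVectorBundle F n) (hL : IsVectorBundle L 1) {x : X}
    {r : Rat (symHom F L)} :
    r ∈ regularAt (symHom F L) x ↔ IsRegularMap (symMap F L r) x := by
  rw [symHom_mem_regularAt_iff hL.isTorsionFree, (hF.sheafHom hL).mem_regularAt_sheafHom_iff]
  rfl

end Symm

end

section

variable {X : Scheme.{0}} [IsIntegral X] [X.Over SpecC]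

/-! ### Symplectic forms on rational sections -/

section Form

variable {F L W E : X.Modules}

/-- The bilinear form on rational sections defined by `ω`. -/
def ratForm (ω : W ⟶ sheafHom W L) :
    Rat W →ₗ[X.functionField] Rat W →ₗ[X.functionField] Rat L :=
  ratHom W L ∘ₗ ratMapK ω

lemma ratForm_toRat (ω : W ⟶ sheafHom W L) {x : X} {U : X.Opens} (hx : x ∈ U) (u v : Γ(W, U)) :
    ratForm ω (toRat W hx u) (toRat W hx v) = toRat L hx (ev (ω.app U u) v) := by
  rw [ratForm, LinearMap.comp_apply, ratMapK_toRat, ratHom_toRat hx hx le_rfl]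
  rfl

lemma IsSymplectic.isAlt {ω : W ⟶ sheafHom W L} (hω : IsSymplectic ω) : (ratForm ω).IsAlt := by
  intro u
  obtain ⟨U, hU, u, rfl⟩ := exists_toRat _ u
  rw [ratForm_toRat, hω.alternating, toRat_zero]

lemma isIsotropic_iff (hL : IsTorsionFree L) (ω : W ⟶ sheafHom W L) (j : E ⟶ W) :
    IsIsotropic ω j ↔ ∀ s t, ratForm ω (ratMapK j s) (ratMapK j t) = 0 := by
  refine ⟨fun h s t ↦ ?_, fun h U s t ↦ hL.eq fun x hx ↦ ?_⟩
  · obtain ⟨U, hU, s, t, rfl, rfl⟩ := exists_toRat₂ _ _ s t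
    rw [ratMapK_toRat, ratMapK_toRat, ratForm_toRat, h, toRat_zero]
  · rw [← ratForm_toRat, ← ratMapK_toRat, ← ratMapK_toRat, h, toRat_zero]

lemma ratHom_quotMap (ω : W ⟶ sheafHom W L) (i : F ⟶ W) (u : Rat W) (f : Rat F) :
    ratHom F L (ratMapK (quotMap ω i) u) f = ratForm ω u (ratMapK i f) := by
  rw [quotMap, ratMapK_comp, ratHom_precomp]
  rfl

/-- The map `g` is the inverse of `ω` on rational sections. It preserves regularity because `ω` is
an isomorphism of sheaves, not only generically. -/
lemma IsSymplectic.exists_dual {m : ℕ} {ω : W ⟶ sheafHom W L} (hω : IsSymplectic ω)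
    (hW : IsVectorBundle W m) :
    ∃ g : (Rat W →ₗ[X.functionField] Rat L) →ₗ[X.functionField] Rat W,
      (∀ f, ratForm ω (g f) = f) ∧ ∀ x f, IsRegularMap f x → g f ∈ regularAt W x := by
  have := hω.nondegenerate
  refine ⟨ratMapK (inv ω) ∘ₗ (hW.ratHomEquiv L).symm.toLinearMap, fun f ↦ ?_, fun x f hf ↦ ?_⟩
  · rw [ratForm, LinearMap.comp_apply, LinearMap.comp_apply, ← ratMapK_comp, IsIso.inv_hom_id,
      ratMapK_id]
    exact hW.ratHom_symm f
  · exact ratMapK_regular _ ((hW.symm_mem_regularAt_iff f).2 hf)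

end Form

/-- `i : F ⟶ W` is a Lagrangian subbundle of the symplectic bundle `(W, ω)` of rank `2n`. -/
structure IsLagrangianSubbundle {F L W : X.Modules} (n : ℕ) (ω : W ⟶ sheafHom W L) (i : F ⟶ W) :
    Prop where
  left : IsVectorBundle F n
  line : IsVectorBundle L 1
  middle : IsVectorBundle W (2 * n)
  symplectic : IsSymplectic ω
  subbundle : IsSubbundle i
  isotropic : IsIsotropic ω i

/-- `σ` is an isotropic rational splitting of the symplectic extension `0 → F → W → F* ⊗ L → 0`. -/
structure IsIsotropicSplitting {F L W : X.Modules} (ω : W ⟶ sheafHom W L) (i : F ⟶ W)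
    (σ : Rat (sheafHom F L) →ₗ[X.functionField] Rat W) : Prop where
  split : ∀ φ, ratMapK (quotMap ω i) (σ φ) = φ
  isotropic : ∀ φ ψ, ratForm ω (σ φ) (σ ψ) = 0

/-! ### Isotropic splittings of the symplectic extension. -/

namespace IsLagrangianSubbundle

variable {F L W : X.Modules} {n : ℕ} {ω : W ⟶ sheafHom W L} {i : F ⟶ W}

section

variable (h : IsLagrangianSubbundle n ω i)

include h

lemma retraction (x : X) :
    ∃ ρ : Rat W →ₗ[X.functionField] Rat F, (∀ f, ρ (ratMapK i f) = f) ∧ IsRegularMap ρ x :=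
  exists_retraction h.left h.middle i h.subbundle x

lemma ratForm_left (f : Rat F) (u : Rat W) :
    ratForm ω (ratMapK i f) u = - ratHom F L (ratMapK (quotMap ω i) u) f := by
  rw [ratHom_quotMap, h.symplectic.isAlt.neg]

lemma quotMap_left (f : Rat F) : ratMapK (quotMap ω i) (ratMapK i f) = 0 :=
  h.left.ratHom_injective (LinearMap.ext fun g ↦ by
    rw [ratHom_quotMap, (isIsotropic_iff h.line.isTorsionFree ω i).1 h.isotropic]; simp)

/-- Isotropy of `F` removes the term in `f` and `g` together. The bracket is the source of symmetry:
when a splitting is changed by `i ∘ p`, it becomes the defect of symmetry of `p`. -/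
lemma ratForm_add {u v : Rat W} {f g : Rat F} :
    ratForm ω (u + ratMapK i f) (v + ratMapK i g) = ratForm ω u v +
      (ratHom F L (ratMapK (quotMap ω i) u) g - ratHom F L (ratMapK (quotMap ω i) v) f) := by
  simp only [map_add, LinearMap.add_apply, h.ratForm_left, ← ratHom_quotMap, h.quotMap_left,
    map_zero, LinearMap.zero_apply]
  abel

lemma left_injective : Function.Injective (ratMapK i) := by
  obtain ⟨ρ, hρ, _⟩ := h.retraction (genericPoint X)
  exact Function.LeftInverse.injective hρ

lemma mem_regularAt_left {x : X} {f : Rat F} (hf : ratMapK i f ∈ regularAt W x) :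
    f ∈ regularAt F x := by
  obtain ⟨ρ, hρ, hρ'⟩ := h.retraction x
  rw [← hρ f]
  exact hρ' _ hf

/-- The adjoint `σ₀` of a regular retraction, given by `ω(σ₀ φ, u) = φ(ρ u)`, splits `π` because `ρ
∘ i = 1`. It need not be isotropic and is corrected by a map into `F`. -/
lemma exists_splitting (x : X) :
    ∃ σ : Rat (sheafHom F L) →ₗ[X.functionField] Rat W, IsIsotropicSplitting ω i σ ∧
      IsRegularMap σ x := by
  obtain ⟨ρ, hρ, hρ'⟩ := h.retraction x
  obtain ⟨g, hg, hg'⟩ := h.symplectic.exists_dual h.middle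
  let σ₀ : Rat (sheafHom F L) →ₗ[X.functionField] Rat W :=
    g ∘ₗ LinearMap.lcomp X.functionField (Rat L) ρ ∘ₗ ratHom F L
  have hσ : ∀ φ u, ratForm ω (σ₀ φ) u = ratHom F L φ (ρ u) := fun φ u ↦
    LinearMap.congr_fun (hg (ratHom F L φ ∘ₗ ρ)) u
  have hs : ∀ φ, ratMapK (quotMap ω i) (σ₀ φ) = φ := fun φ ↦
    h.left.ratHom_injective (LinearMap.ext fun f ↦ by rw [ratHom_quotMap, hσ, hρ])
  have hr : IsRegularMap σ₀ x := fun φ hφ ↦ hg' x _ fun w hw ↦ ratHom_mem hφ (hρ' w hw)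
  -- Adding `c • i ∘ ρ ∘ σ₀` multiplies the pullback of `ω` along the splitting by `1 + 2c`, which
  -- vanishes for `c = -1/2`.
  let c : X.functionField := constStalk X (genericPoint X) (-2⁻¹)
  have hc : 1 + c + c = 0 := by
    have : c + c = -1 := by
      rw [← map_add, ← map_one (constStalk X (genericPoint X)), ← map_neg]
      norm_num
    rw [add_assoc, this, add_neg_cancel]
  refine ⟨σ₀ + ratMapK i ∘ₗ (c • ρ ∘ₗ σ₀), ⟨fun φ ↦ ?_, fun φ ψ ↦ ?_⟩, fun φ hφ ↦ ?_⟩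
  · change ratMapK (quotMap ω i) (σ₀ φ + ratMapK i _) = φ
    rw [map_add, h.quotMap_left, add_zero, hs]
  · simp only [LinearMap.add_apply, LinearMap.comp_apply, LinearMap.smul_apply]
    rw [h.ratForm_add, hs, hs, map_smul, map_smul, ← hσ, ← hσ, ← h.symplectic.isAlt.neg (σ₀ φ)]
    rw [smul_neg, sub_neg_eq_add, ← add_assoc, ← one_smul X.functionField (ratForm ω (σ₀ φ) (σ₀ ψ)),
      smul_smul, ← add_smul, ← add_smul, mul_one, hc, zero_smul]
  · refine add_mem (hr φ hφ) (ratMapK_regular i ?_)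
    exact (regularAt F x).smul_mem (-2⁻¹ : ℂ) (hρ' _ (hr φ hφ))

/-- Dimension count: the quotient map has a section, so its kernel has dimension `2n - n = n`, which
is that of the image of `F` inside it. -/
lemma exists_of_quotMap_eq_zero {u : Rat W} (hu : ratMapK (quotMap ω i) u = 0) :
    ∃ f, ratMapK i f = u := by
  have := h.left.finiteDimensional_rat
  have := h.middle.finiteDimensional_rat
  obtain ⟨σ, hσ, _⟩ := h.exists_splitting (genericPoint X)
  have h1 : LinearMap.range (ratMapK i) ≤ LinearMap.ker (ratMapK (quotMap ω i)) := by
    rintro _ ⟨f, rfl⟩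
    exact h.quotMap_left f
  have h2 := LinearMap.finrank_range_add_finrank_ker (ratMapK (quotMap ω i))
  rw [LinearMap.range_eq_top.2 (Function.RightInverse.surjective hσ.split), finrank_top,
    (h.left.sheafHom h.line).finrank_rat, h.middle.finrank_rat] at h2
  have h3 := LinearMap.finrank_range_of_inj h.left_injective
  rw [h.left.finrank_rat] at h3
  have h4 := Submodule.eq_of_le_of_finrank_eq h1 (by rw [h3]; omega)
  exact h4.ge hu

lemma exists_sub_eq {σ τ : Rat (sheafHom F L) →ₗ[X.functionField] Rat W}
    (hσ : ∀ φ, ratMapK (quotMap ω i) (σ φ) = φ) (hτ : ∀ φ, ratMapK (quotMap ω i) (τ φ) = φ) :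
    ∃ p : Rat (sheafHom F L) →ₗ[X.functionField] Rat F, ∀ φ, τ φ = σ φ + ratMapK i (p φ) := by
  obtain ⟨ρ, hρ, _⟩ := h.retraction (genericPoint X)
  refine ⟨ρ ∘ₗ (τ - σ), fun φ ↦ ?_⟩
  obtain ⟨f, hf⟩ := h.exists_of_quotMap_eq_zero (u := (τ - σ) φ) (by
    rw [LinearMap.sub_apply, map_sub, hσ, hτ, sub_self])
  rw [LinearMap.comp_apply, ← hf, hρ, hf, LinearMap.sub_apply, add_sub_cancel]

end

end IsLagrangianSubbundle

end

section

variable {X : Scheme.{0}} [IsIntegral X] [X.Over SpecC]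

/-! ### Principal parts -/

lemma H1.mk_eq_iff {M : X.Modules} {p q : PrinRep M} :
    H1.mk M p = H1.mk M q ↔ ∃ β : Rat M, ∀ x, p.1 x - q.1 x - β ∈ regularAt M x :=
  Submodule.Quotient.eq _

lemma H1.mk_surjective (M : X.Modules) : Function.Surjective (H1.mk M) :=
  Submodule.mkQ_surjective _

lemma H1.map_mk {M N : X.Modules} (f : M ⟶ N) (p : PrinRep M) :
    H1.map f (H1.mk M p) = H1.mk N (prinMap f p) := rfl

lemma isRegularMap_ratHom_iff {M N : X.Modules} {n : ℕ} (hM : IsVectorBundle M n) {x : X}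
    {r : Rat (sheafHom M N)} :
    r ∈ regularAt (sheafHom M N) x ↔ IsRegularMap (ratHom M N r) x :=
  hM.mem_regularAt_sheafHom_iff

lemma isExtensionClass_iff {F W Q : X.Modules} {m : ℕ} (hQ : IsVectorBundle Q m) (i : F ⟶ W)
    (π : W ⟶ Q) (e : H1 (sheafHom Q F)) :
    IsExtensionClass i π e ↔ ∃ σ : Rat Q →ₗ[X.functionField] Rat W, (∀ φ, ratMapK π (σ φ) = φ) ∧
      ∃ p : PrinRep (sheafHom Q F), H1.mk _ p = e ∧
        ∀ x, IsRegularMap (σ + ratMapK i ∘ₗ ratHom Q F (p.1 x)) x := by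
  have key : ∀ (r : Rat (sheafHom Q W)) (q : Rat (sheafHom Q F)) x,
      r + ratMap (postcomp Q i) q ∈ regularAt (sheafHom Q W) x ↔
        IsRegularMap (ratHom Q W r + ratMapK i ∘ₗ ratHom Q F q) x := fun r q x ↦ by
    rw [isRegularMap_ratHom_iff hQ, map_add, ratMap_eq_ratMapK]
    rw [show ratHom Q W (ratMapK (postcomp Q i) q) = ratMapK i ∘ₗ ratHom Q F q from
      LinearMap.ext fun φ ↦ ratHom_postcomp Q i q φ]
  have key' : ∀ r : Rat (sheafHom Q W), ratMap (postcomp Q π) r =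
      toRat (sheafHom Q Q) (U := ⊤) (Opens.mem_top (genericPoint X)) (idSec Q) ↔
        ∀ φ, ratMapK π (ratHom Q W r φ) = φ := fun r ↦ by
    rw [← hQ.ratHom_injective.eq_iff, LinearMap.ext_iff]
    simp only [ratHom_idSec, ratMap_eq_ratMapK, ratHom_postcomp]
  refine ((hQ.ratHomEquiv W).surjective.exists.trans ?_).symm
  refine exists_congr fun r ↦ and_congr (key' r).symm ?_
  exact exists_congr fun p ↦ and_congr Iff.rfl (forall_congr' fun x ↦ (key r _ x).symm)

/-- The definition allows a representative that is not symmetric. It differs from `P` by a rational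
section `β` up to regular terms, and `β` is absorbed into the splitting. -/
lemma isExtensionClass_map_mk_iff {F L W : X.Modules} {n : ℕ} {ω : W ⟶ sheafHom W L} {i : F ⟶ W}
    (h : IsLagrangianSubbundle n ω i) (P : PrinRep (symHom F L)) :
    IsExtensionClass i (quotMap ω i) (H1.map (symHomι F L) (H1.mk _ P)) ↔
      ∃ σ : Rat (sheafHom F L) →ₗ[X.functionField] Rat W,
        (∀ φ, ratMapK (quotMap ω i) (σ φ) = φ) ∧
        ∀ x, IsRegularMap (σ + ratMapK i ∘ₗ symMap F L (P.1 x)) x := by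
  rw [isExtensionClass_iff (h.left.sheafHom h.line)]
  constructor
  · rintro ⟨σ, hσ, p, hp, hreg⟩
    rw [H1.map_mk, H1.mk_eq_iff] at hp
    obtain ⟨β, hβ⟩ := hp
    refine ⟨σ + ratMapK i ∘ₗ ratHom _ F β, fun φ ↦ ?_, fun x ↦ ?_⟩
    · change ratMapK (quotMap ω i) (σ φ + ratMapK i _) = φ
      rw [map_add, h.quotMap_left, add_zero, hσ]
    · intro φ hφ
      have h1 := sub_mem (hreg x φ hφ) (ratMapK_regular i (ratHom_mem (hβ x) hφ))
      refine (congr_arg (· ∈ regularAt W x) ?_).mpr h1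
      have h2 : (prinMap (symHomι F L) P).1 x = ratMapK (symHomι F L) (P.1 x) := rfl
      simp only [LinearMap.add_apply, LinearMap.comp_apply, map_sub, LinearMap.sub_apply, h2,
        symMap]
      abel
  · rintro ⟨σ, hσ, hreg⟩
    exact ⟨σ, hσ, _, rfl, hreg⟩

/-- Symmetric principal parts that represent the class of the extension have the same class. -/
lemma IsLagrangianSubbundle.mk_eq {F L W : X.Modules} {n : ℕ} {ω : W ⟶ sheafHom W L} {i : F ⟶ W}
    (h : IsLagrangianSubbundle n ω i) {P P' : PrinRep (symHom F L)}
    {σ σ' : Rat (sheafHom F L) →ₗ[X.functionField] Rat W}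
    (hσ : ∀ φ, ratMapK (quotMap ω i) (σ φ) = φ)
    (hP : ∀ x, IsRegularMap (σ + ratMapK i ∘ₗ symMap F L (P.1 x)) x)
    (hσ' : ∀ φ, ratMapK (quotMap ω i) (σ' φ) = φ)
    (hP' : ∀ x, IsRegularMap (σ' + ratMapK i ∘ₗ symMap F L (P'.1 x)) x) :
    H1.mk _ P = H1.mk _ P' := by
  obtain ⟨β, hβ⟩ := h.exists_sub_eq hσ hσ'
  -- The splittings are not assumed isotropic, so `β` need not be symmetric. Since `P - P'` is
  -- symmetric, `β` may be replaced by its symmetrization.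
  obtain ⟨β', hs, hβ'⟩ := exists_symmetrization h.left h.line β
  obtain ⟨r, hr⟩ := exists_symHom h.left h.line hs
  refine H1.mk_eq_iff.2 ⟨r, fun x ↦ (symHom_regular_iff h.left h.line).2 ?_⟩
  rw [map_sub, symMap_apply r, hr]
  refine hβ' x _ (isSymmetricMap_ratMapK _) fun φ hφ ↦ h.mem_regularAt_left ?_
  refine (congr_arg (· ∈ regularAt W x) ?_).mpr (sub_mem (hP x φ hφ) (hP' x φ hφ))
  change ratMapK i (symMap F L (P.1 x - P'.1 x) φ - β φ) = _
  simp only [LinearMap.add_apply, LinearMap.comp_apply, map_sub, LinearMap.sub_apply, hβ]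
  abel

lemma hom_ext_of_ratMapK {M N : X.Modules} (hN : IsTorsionFree N) {f g : M ⟶ N}
    (h : ∀ r, ratMapK f r = ratMapK g r) : f = g := by
  refine Scheme.Modules.hom_ext _ _ fun U ↦ ?_
  ext s
  refine hN.eq fun x hx ↦ ?_
  rw [← ratMapK_toRat, ← ratMapK_toRat, h]

/-- A morphism from a map on rational sections that preserves regularity. -/
lemma exists_hom_of_ratMap {M N : X.Modules} (hN : IsTorsionFree N)
    (f : Rat M →ₗ[X.functionField] Rat N) (hf : ∀ x, IsRegularMap f x) :
    ∃ j : M ⟶ N, ∀ r, ratMapK j r = f r := by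
  have key : ∀ (U : X.Opens) (s : Γ(M, U)), ∃ t : Γ(N, U), ∀ (x : X) (hx : x ∈ U),
      toRat N hx t = f (toRat M hx s) := fun U s ↦ by
    by_cases hU : ∃ x, x ∈ U
    · obtain ⟨x, hx⟩ := hU
      exact hN.exists_section U (f (toRat M hx s)) fun y hy ↦
        hf y _ (toRat_mem_regularAt M hy s)
    · exact ⟨0, fun x hx ↦ (hU ⟨x, hx⟩).elim⟩
  choose g hg using key
  refine ⟨mkHom (fun U ↦
    { toFun := g U
      map_add' := fun s t ↦ hN.eq fun x hx ↦ by simp only [toRat_add, hg, map_add]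
      map_smul' := fun r s ↦ hN.eq fun x hx ↦ by
        simp only [toRat_fsmul, hg, map_smul, RingHom.id_apply] })
    fun U V h m ↦ hN.eq fun x hx ↦ ?_, fun r ↦ ?_⟩
  · change toRat N hx (g V _) = _
    rw [hg, toRat_res M h (h hx), toRat_res N h (h hx)]
    exact (hg _ _ _ _).symm
  · obtain ⟨U, hU, s, rfl⟩ := exists_toRat M r
    rw [ratMapK_toRat, ← hg U s _ hU]
    rfl

end

/-! ### The class of a symplectic extension -/

section Curve

variable {C : Scheme.{0}} [C.Over SpecC] [IsSmoothProjectiveCurve C] {F L W : C.Modules} {n : ℕ}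
  {ω : W ⟶ sheafHom W L} {i : F ⟶ W}

/-- The constant family with value a rational section. -/
def constPrin {M : C.Modules} (r : Rat M) : PrinRep M :=
  ⟨fun _ ↦ r, by
    obtain ⟨U, hU, s, rfl⟩ := exists_toRat M r
    exact (finite_compl hU).subset fun x hx hxU ↦ hx ⟨U, hxU, s, rfl⟩⟩

/-- With both splittings isotropic, only the bracket in `ratForm_add` remains. -/
lemma IsLagrangianSubbundle.isSymmetricMap (h : IsLagrangianSubbundle n ω i)
    {σ τ : Rat (sheafHom F L) →ₗ[C.functionField] Rat W} (hσ : IsIsotropicSplitting ω i σ)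
    (hτ : IsIsotropicSplitting ω i τ) {p : Rat (sheafHom F L) →ₗ[C.functionField] Rat F}
    (hp : ∀ φ, τ φ = σ φ + ratMapK i (p φ)) : IsSymmetricMap p := by
  intro φ ψ
  have h1 := hτ.isotropic φ ψ
  rw [hp, hp, h.ratForm_add, hσ.isotropic, hσ.split, hσ.split, zero_add, sub_eq_zero] at h1
  exact h1.symm

lemma IsLagrangianSubbundle.exists_class (h : IsLagrangianSubbundle n ω i) :
    ∃ (σ : Rat (sheafHom F L) →ₗ[C.functionField] Rat W) (P : PrinRep (symHom F L)),
      IsIsotropicSplitting ω i σ ∧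
        ∀ x, IsRegularMap (σ + ratMapK i ∘ₗ symMap F L (P.1 x)) x := by
  obtain ⟨σ, hσ, -⟩ := h.exists_splitting (genericPoint C)
  have hQ := h.left.sheafHom h.line
  -- The value `0` is imposed wherever `σ` is already regular. This makes the family vanish at all
  -- but finitely many points, as `σ` is regular near the generic point.
  have key : ∀ x, ∃ r : Rat (symHom F L), IsRegularMap (σ + ratMapK i ∘ₗ symMap F L r) x ∧
      (IsRegularMap σ x → r = 0) := fun x ↦ by
    by_cases hx : IsRegularMap σ x
    · exact ⟨0, by simpa using hx, fun _ ↦ rfl⟩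
    · obtain ⟨τ, hτ, hreg⟩ := h.exists_splitting x
      obtain ⟨p, hp⟩ := h.exists_sub_eq hσ.split hτ.split
      obtain ⟨r, hr⟩ := exists_symHom h.left h.line (h.isSymmetricMap hσ hτ hp)
      refine ⟨r, fun φ hφ ↦ ?_, fun h ↦ (hx h).elim⟩
      rw [LinearMap.add_apply, LinearMap.comp_apply, symMap_apply, hr, ← hp]
      exact hreg φ hφ
  choose P hP hP' using key
  refine ⟨σ, ⟨P, ?_⟩, hσ, hP⟩
  obtain ⟨U, hU, a, ha⟩ := exists_toRat _ ((hQ.ratHomEquiv W).symm σ)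
  refine (finite_compl hU).subset fun x hx hxU ↦ hx ?_
  rw [hP' x ((hQ.symm_mem_regularAt_iff σ).1 (ha ▸ toRat_mem_regularAt _ hxU a))]
  exact zero_mem _

/-- The principal parts that map `E` to regular sections of `F`. -/
def regularOn (E : C.Modules) (γ : E ⟶ sheafHom F L) : Submodule ℂ (PrinRep (symHom F L)) where
  carrier := {P | ∀ x, ∀ s ∈ regularAt E x, symMap F L (P.1 x) (ratMapK γ s) ∈ regularAt F x}
  zero_mem' x s _ := by
    change symMap F L 0 _ ∈ _
    rw [map_zero]
    exact zero_mem _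
  add_mem' {P P'} h h' x s hs := by
    change symMap F L (P.1 x + P'.1 x) _ ∈ _
    rw [map_add]
    exact add_mem (h x s hs) (h' x s hs)
  smul_mem' c P h x s hs := by
    change symMap F L (c • P.1 x) _ ∈ _
    rw [csmul_eq, map_smul]
    exact (regularAt F x).smul_mem c (h x s hs)

/-! ### Lagrangian lifts and principal parts regular on `E`. -/

lemma exists_lagrangianSubsheaf_iff (h : IsLagrangianSubbundle n ω i) {E : C.Modules}
    {γ : E ⟶ sheafHom F L} [Mono γ] (hγ : Function.Bijective (ratMapK γ))
    {σ : Rat (sheafHom F L) →ₗ[C.functionField] Rat W} {P : PrinRep (symHom F L)}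
    (hσ : IsIsotropicSplitting ω i σ)
    (hP : ∀ x, IsRegularMap (σ + ratMapK i ∘ₗ symMap F L (P.1 x)) x) :
    (∃ j : E ⟶ W, j ≫ quotMap ω i = γ ∧ IsLagrangianSubsheaf n ω j) ↔
      H1.mk _ P ∈ (regularOn E γ).map (H1.mk (symHom F L)) := by
  have hL := h.line.isTorsionFree
  have hQ := h.left.sheafHom h.line
  have hW := h.middle.isTorsionFree
  let Γ := LinearEquiv.ofBijective (ratMapK γ) hγ
  constructor
  · rintro ⟨j, hj, hj'⟩
    -- A lift is turned into the splitting `j ∘ γ⁻¹` on rational sections, isotropic because the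
    -- image of `j` is.
    let τ : Rat (sheafHom F L) →ₗ[C.functionField] Rat W := ratMapK j ∘ₗ Γ.symm.toLinearMap
    have hτj : ∀ s, τ (ratMapK γ s) = ratMapK j s := fun s ↦
      congr_arg (ratMapK j) (Γ.symm_apply_apply s)
    have hτ : IsIsotropicSplitting ω i τ := by
      refine ⟨fun φ ↦ ?_, fun φ ψ ↦ (isIsotropic_iff hL ω j).1 hj'.isotropic _ _⟩
      rw [LinearMap.comp_apply, ← ratMapK_comp, hj]
      exact Γ.apply_symm_apply φ
    obtain ⟨p, hp⟩ := h.exists_sub_eq hσ.split hτ.split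
    obtain ⟨b, hb⟩ := exists_symHom h.left h.line (h.isSymmetricMap hσ hτ hp)
    -- Subtracting the principal part of the rational section `b` does not change the class. On `E`,
    -- the map `i ∘ (p x - b)` is the difference of the regular maps `σ + i ∘ p x` and `j`.
    refine ⟨P - constPrin b, fun x s hs ↦ h.mem_regularAt_left ?_, ?_⟩
    · have h1 := sub_mem (hP x _ (ratMapK_regular γ hs)) (ratMapK_regular j hs)
      refine (congr_arg (· ∈ regularAt W x) ?_).mpr h1
      change ratMapK i (symMap F L (P.1 x - b) _) = _
      rw [← hτj, hp, map_sub, LinearMap.sub_apply, symMap_apply b, hb, map_sub]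
      simp only [LinearMap.add_apply, LinearMap.comp_apply]
      abel
    · refine H1.mk_eq_iff.2 ⟨-b, fun x ↦ ?_⟩
      change P.1 x - b - P.1 x - -b ∈ _
      rw [show P.1 x - b - P.1 x - -b = 0 by abel]
      exact zero_mem _
  · rintro ⟨P', hP', hPP'⟩
    obtain ⟨b, hb⟩ := H1.mk_eq_iff.1 hPP'.symm
    -- Conversely, `b` is the rational section by which `P` and `P'` differ up to regular terms.
    -- Symmetry of `b` keeps `σ + i ∘ b` isotropic, and regularity of `P'` on `E` makes it regular
    -- there.
    let τ : Rat (sheafHom F L) →ₗ[C.functionField] Rat W := σ + ratMapK i ∘ₗ symMap F L b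
    have hτs : ∀ φ, ratMapK (quotMap ω i) (τ φ) = φ := fun φ ↦ by
      change ratMapK (quotMap ω i) (σ φ + ratMapK i _) = φ
      rw [map_add, h.quotMap_left, add_zero, hσ.split]
    have hτi : ∀ φ ψ, ratForm ω (τ φ) (τ ψ) = 0 := fun φ ψ ↦ by
      change ratForm ω (σ φ + ratMapK i (symMap F L b φ)) (σ ψ + ratMapK i (symMap F L b ψ)) = 0
      rw [h.ratForm_add, hσ.isotropic, hσ.split, hσ.split, zero_add, sub_eq_zero]
      exact (isSymmetricMap_ratMapK b φ ψ).symm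
    have hreg : ∀ x, ∀ s ∈ regularAt E x, τ (ratMapK γ s) ∈ regularAt W x := fun x s hs ↦ by
      have h1 := ratMapK_regular γ hs
      refine (congr_arg (· ∈ regularAt W x) ?_).mpr (sub_mem (sub_mem (hP x _ h1)
        (ratMapK_regular i ((symHom_regular_iff h.left h.line).1 (hb x) _ h1)))
          (ratMapK_regular i (hP' x s hs)))
      simp only [τ, LinearMap.add_apply, LinearMap.comp_apply, map_sub, LinearMap.sub_apply]
      abel
    obtain ⟨j, hj⟩ := exists_hom_of_ratMap hW (τ ∘ₗ ratMapK γ) hreg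
    have hjγ : j ≫ quotMap ω i = γ := by
      refine hom_ext_of_ratMapK hQ.isTorsionFree fun s ↦ ?_
      rw [ratMapK_comp, hj]
      exact hτs _
    have : Mono (j ≫ quotMap ω i) := hjγ ▸ inferInstance
    refine ⟨j, hjγ, mono_of_mono j (quotMap ω i), ?_, ?_⟩
    · refine (isIsotropic_iff hL ω j).2 fun s t ↦ ?_
      rw [hj, hj]
      exact hτi _ _
    · rw [Γ.finrank_eq, hQ.finrank_rat]

end Curve

section

variable {X : Scheme.{0}}

lemma app_injective_of_mono {M N : X.Modules} (f : M ⟶ N) [Mono f] (U : X.Opens) :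
    Function.Injective (f.app U) := by
  have : Mono ((Scheme.Modules.toPresheaf X).map f) := inferInstance
  rw [NatTrans.mono_iff_mono_app] at this
  exact (AddCommGrpCat.mono_iff_injective _).1 (this (op U))

/-! ### Values and regularity -/

/-- By linearity `φ` maps `m_x F` into `m_x L`; a frame expresses `s` with coefficients in `m_x`. -/
lemma value_apply_eq_zero {F L : X.Modules} {n : ℕ} (hF : IsVectorBundle F n) {x : X}
    {V : X.Opens} (hx : x ∈ V) (φ : HomSec F L V) {s : Γ(F, V)} (hs : value F hx s = 0) :
    value L hx (φ.app V le_rfl s) = 0 := by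
  obtain ⟨T, hTV, hT, e, he⟩ := hF.exists_frame_le hx
  obtain ⟨c, hc⟩ := (he T le_rfl).2 (res F hTV s)
  simp only [res_self] at hc
  rw [← value_res F hTV hT, ← hc, he.value_eq_zero_iff hT] at hs
  rw [← value_res L hTV hT, ← φ.app_res V T le_rfl hTV, ← hc, map_sum, value_eq_zero_iff]
  simp only [map_smul]
  rw [germ_sum_smul]
  exact sum_mem fun a _ ↦ Submodule.smul_mem_smul (hs a) trivial

variable [IsIntegral X] [X.Over SpecC]

omit [X.Over SpecC] in
-- Together with `value_eq_zero_of_mem`, this translates the vanishing of a value in the fibre of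
-- `L` into a condition on rational sections.
lemma exists_of_value_eq_zero {L : X.Modules} {V T : X.Opens} {l : Fin 1 → Γ(L, V)}
    (hl : IsFrame l) {x : X} (hV : x ∈ V) (hT : x ∈ T) {u : Γ(L, T)} (hu : value L hT u = 0) :
    ∃ c ∈ IsLocalRing.maximalIdeal (X.presheaf.stalk x),
      toRat L hT u = algebraMap (X.presheaf.stalk x) X.functionField c • toRat L hV (l 0) := by
  have hx : x ∈ V ⊓ T := ⟨hV, hT⟩
  obtain ⟨c, hc⟩ := (hl (V ⊓ T) inf_le_left).2 (res L inf_le_right u)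
  replace hc : ∑ i, c i • res L inf_le_left (l i) = res L inf_le_right u := hc
  have h1 := ((hl.res (inf_le_left : V ⊓ T ≤ V)).value_eq_zero_iff hx c).1 (by
    rw [hc, value_res, hu])
  refine ⟨_, h1 0, ?_⟩
  rw [← toRat_res L inf_le_right hT hx, ← hc, toRat_sum_smul, algebraMap_germ]
  simp [toRat_res L inf_le_left hV hx]

omit [X.Over SpecC] in
lemma value_eq_zero_of_mem {L : X.Modules} (hL : IsTorsionFree L) {V T : X.Opens} {l : Γ(L, V)}
    {x : X} (hV : x ∈ V) (hT : x ∈ T) {u : Γ(L, T)} {c : X.presheaf.stalk x}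
    (hc : c ∈ IsLocalRing.maximalIdeal (X.presheaf.stalk x))
    (hu : toRat L hT u = algebraMap (X.presheaf.stalk x) X.functionField c • toRat L hV l) :
    value L hT u = 0 := by
  obtain ⟨A, hA, hxA, f, hf⟩ := exists_germO_eq_le (U := V ⊓ T) ⟨hV, hT⟩ fun _ : Fin 1 ↦ c
  have h1 : res L (hA.trans inf_le_right) u = f 0 • res L (hA.trans inf_le_left) l :=
    hL.eq fun y hy ↦ by
      rw [toRat_fsmul, toRat_res L _ hT, toRat_res L _ hV, hu, ← hf 0, algebraMap_germ]
  rw [← value_res L (hA.trans inf_le_right) hxA, h1, value_eq_zero_iff, germ_smul, hf]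
  exact Submodule.smul_mem_smul hc trivial

/-- A section with nonzero value is part of a frame: it is sent to a generator of `L` by a regular
section of `F* ⊗ L`. -/
lemma exists_eq_of_value_ne_zero {F L : X.Modules} {n : ℕ} (hF : IsVectorBundle F n) {x : X}
    {U V : X.Opens} (hU : x ∈ U) {s : Γ(F, U)} (hs : value F hU s ≠ 0) (hV : x ∈ V)
    (l : Γ(L, V)) :
    ∃ φ ∈ regularAt (sheafHom F L) x, ratHom F L φ (toRat F hU s) = toRat L hV l := by
  obtain ⟨T, hT, hxT, e, he⟩ := hF.exists_frame_le (U := U ⊓ V) (x := x) ⟨hU, hV⟩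
  have hTU := hT.trans inf_le_left
  have hTV := hT.trans inf_le_right
  obtain ⟨c, hc⟩ := (he T le_rfl).2 (res F hTU s)
  simp only [res_self] at hc
  -- Some coefficient of `s` is a unit at `x`. The corresponding dual frame section, divided by this
  -- unit, sends `s` to `l`.
  obtain ⟨a, ha⟩ : ∃ a, X.presheaf.germ T x hxT (c a) ∉
      IsLocalRing.maximalIdeal (X.presheaf.stalk x) := by
    by_contra! h
    rw [← he.value_eq_zero_iff hxT, hc, value_res] at h
    exact hs h
  obtain ⟨φ, hφ, h⟩ := he.exists_dual hxT (res L hTV l) a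
  obtain ⟨g, hg⟩ := not_not.1 ((IsLocalRing.mem_maximalIdeal _).not.1 ha)
  refine ⟨algebraMap (X.presheaf.stalk x) X.functionField (g⁻¹ : (X.presheaf.stalk x)ˣ) • φ,
    smul_mem_regularAt _ hφ, ?_⟩
  rw [← toRat_res F hTU hU hxT, ← hc, toRat_sum_smul, map_smul, map_sum]
  simp only [LinearMap.smul_apply, map_smul, h, smul_ite, smul_zero, Finset.sum_ite_eq',
    Finset.mem_univ, if_true]
  rw [← algebraMap_germ hxT, ← hg, smul_smul, ← map_mul, Units.mul_inv, map_one, one_smul,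
    toRat_res]

/-! ### The sections `λ ⊗ s ⊗ s` -/

lemma isFrame_structureModule (X : Scheme.{0}) :
    IsFrame (M := structureModule X) (U := ⊤) fun _ : Fin 1 ↦ (1 : Γ(X, ⊤)) := by
  intro V hV
  have h : ∀ c : Fin 1 → Γ(X, V), ∑ i, c i • res (structureModule X) hV (1 : Γ(X, ⊤)) =
      (c 0 : Γ(X, V)) := fun c ↦ by
    have : res (structureModule X) hV (1 : Γ(X, ⊤)) = (1 : Γ(X, V)) := map_one (resO X hV)
    rw [Fin.sum_univ_one, this]
    exact mul_one (c 0)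
  constructor
  · intro c d hcd
    simp only [h] at hcd
    funext i
    rw [Subsingleton.elim i 0]
    exact hcd
  · intro c
    exact ⟨fun _ ↦ c, h _⟩

lemma isVectorBundle_structureModule (X : Scheme.{0}) : IsVectorBundle (structureModule X) 1 :=
  fun _ ↦ ⟨⊤, trivial, _, isFrame_structureModule X⟩

omit [X.Over SpecC] in
-- Extends `λ` to a `K`-linear functional `Λ` on rational sections, so that `λ ⊗ s ⊗ s` becomes a
-- rank one formula. The unit `g` records that `λ` generates `L⁻¹`, which is needed to divide by it
-- in the local computation.
lemma exists_squareSec_functional {F L : X.Modules} (hL : IsVectorBundle L 1) {x : X}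
    {U : X.Opens} (hx : x ∈ U) (l : Γ(dual L, U)) (hl : IsFrame (M := dual L) fun _ : Fin 1 ↦ l)
    (s : Γ(F, U)) :
    ∃ (Λ : Rat L →ₗ[X.functionField] X.functionField) (V : X.Opens) (hV : x ∈ V)
      (l₀ : Fin 1 → Γ(L, V)) (g : (X.presheaf.stalk x)ˣ), IsFrame l₀ ∧
      Λ (toRat L hV (l₀ 0)) = algebraMap (X.presheaf.stalk x) X.functionField g ∧
      ∀ φ, ratHom (sheafHom F L) F (toRat _ hx (squareSec l s)) φ =
        Λ (ratHom F L φ (toRat F hx s)) • toRat F hx s := by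
  obtain ⟨V, hVU, hV, l₀, hl₀⟩ := hL.exists_frame_le hx
  let l' : HomSec L (structureModule X) U := l
  let g : Γ(X, V) := l'.app V hVU (l₀ 0)
  have hg : IsUnit g := by
    -- The section dual to `l₀` is a multiple `c • λ`; evaluating at `l₀` gives `c g = 1`.
    let μ : HomSec L (structureModule X) V := hl₀.constr fun _ ↦ (1 : Γ(X, V))
    obtain ⟨c, hc⟩ := (hl V hVU).2 μ
    replace hc : c 0 • res (dual L) hVU l = μ := (Fin.sum_univ_one _).symm.trans hc
    have h1 := congr_arg (fun α : HomSec L (structureModule X) V ↦ α.app V le_rfl (l₀ 0)) hc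
    have h2 : μ.app V le_rfl (l₀ 0) = (1 : Γ(X, V)) := hl₀.constr_app _ 0
    refine IsUnit.of_mul_eq_one (c 0) ?_
    rw [mul_comm]
    refine Eq.trans ?_ (h1.trans h2)
    change c 0 * g = resO X le_rfl (c 0) * g
    rw [resO_self]
  let Λ := (hl₀.ratBasis hV).constr X.functionField
    fun _ ↦ (X.presheaf.germ V (genericPoint X) (generic_mem hV) g : X.functionField)
  have hΛ : Λ (toRat L hV (l₀ 0)) =
      (X.presheaf.germ V (genericPoint X) (generic_mem hV) g : X.functionField) := by
    rw [← hl₀.ratBasis_apply, Module.Basis.constr_basis]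
  obtain ⟨g', hg'⟩ := hg.map (X.presheaf.germ V x hV).hom
  refine ⟨Λ, V, hV, l₀, g', hl₀, ?_, fun φ ↦ ?_⟩
  · rw [hΛ, hg']
    exact (algebraMap_germ hV g).symm
  · obtain ⟨T, hTV, hT, (f : HomSec F L T), rfl⟩ :=
      exists_toRat_le (sheafHom F L) φ (U := V) (generic_mem hV)
    have hTU := hTV.trans hVU
    obtain ⟨c, hc⟩ := (hl₀ T hTV).2 (f.app T le_rfl (res F hTU s))
    replace hc : c 0 • res L hTV (l₀ 0) = f.app T le_rfl (res F hTU s) :=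
      (Fin.sum_univ_one _).symm.trans hc
    have e1 := ratHom_toRat (M := sheafHom F L) hx hT hTU (squareSec l s) f
    have e2 := ratHom_toRat (M := F) (N := L) hT hT le_rfl f (res F hTU s)
    rw [toRat_res F hTU hx hT] at e2
    refine e1.trans ?_
    refine Eq.trans ?_ (congr_arg (fun u ↦ Λ u • toRat F hx s) e2.symm)
    have e3 : l'.app T hTU (f.app T le_rfl (res F hTU s)) = c 0 * resO X hTV g := by
      rw [← hc, map_smul, l'.app_res V T hVU hTV]
      rfl
    have e4 : HomSec.app (squareSec l s) T hTU f =
        (c 0 * resO X hTV g) • res F hTU s :=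
      congr_arg (fun c : Γ(X, T) ↦ c • res F hTU s) e3
    have e5 : HomSec.app f T le_rfl (res F hTU s) = c 0 • res L hTV (l₀ 0) := hc.symm
    rw [e4]
    refine Eq.trans ?_ (congr_arg (fun u ↦ Λ (toRat L hT u) • toRat F hx s) e5.symm)
    simp only [toRat_fsmul, map_mul, germ_resO, toRat_res F hTU hx hT, map_smul,
      toRat_res L hTV hV hT, hΛ, smul_eq_mul]

omit [X.Over SpecC] in
-- Rational sections of `L` form a `K`-line, so `Λ(u) v = Λ(v) u` for `u = φ(s)` and `v = ψ(s)`.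
lemma isSymmetricMap_squareSec {F L : X.Modules} (hL : IsVectorBundle L 1) {x : X}
    {U : X.Opens} (hx : x ∈ U) (l : Γ(dual L, U)) (hl : IsFrame (M := dual L) fun _ : Fin 1 ↦ l)
    (s : Γ(F, U)) :
    IsSymmetricMap (ratHom (sheafHom F L) F (toRat _ hx (squareSec l s))) := by
  obtain ⟨Λ, V, hV, l₀, g, hl₀, -, h⟩ := exists_squareSec_functional hL hx l hl s
  intro φ ψ
  have key : ∀ u : Rat L, ∃ c : X.functionField, u = c • toRat L hV (l₀ 0) := fun u ↦
    ⟨(hl₀.ratBasis hV).repr u 0, by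
      conv_lhs => rw [← (hl₀.ratBasis hV).sum_repr u]
      rw [Fin.sum_univ_one, hl₀.ratBasis_apply]⟩
  obtain ⟨c, hc⟩ := key (ratHom F L φ (toRat F hx s))
  obtain ⟨d, hd⟩ := key (ratHom F L ψ (toRat F hx s))
  rw [h, h, map_smul, map_smul, hc, hd]
  simp only [map_smul, smul_smul, smul_eq_mul]
  congr 1
  ring

end

/-! ### Principal parts with a simple pole -/

section

variable {C : Scheme.{0}} [C.Over SpecC] [IsSmoothProjectiveCurve C] {F L : C.Modules} {n : ℕ}

/-- The rational section `φ` of `F* ⊗ L` maps `f` into `m_x L`. -/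
def VanishesOn (φ : Rat (sheafHom F L)) (x : C) (f : Rat F) : Prop :=
  ∃ c ∈ IsLocalRing.maximalIdeal (C.presheaf.stalk x), ∃ u ∈ regularAt L x,
    ratHom F L φ f = algebraMap (C.presheaf.stalk x) C.functionField c • u

/-- The data in the definition of the point `ψ(η)`, without the condition that it is defined:
`r` is `λ ⊗ s ⊗ s / z`. -/
def IsPsiSection {x : C} (η : ℙ ℂ (Fiber F x)) (U : C.Opens) (hx : x ∈ U) (s : Γ(F, U))
    (r : Rat (symHom F L)) : Prop :=
  ∃ (hs : value F hx s ≠ 0) (l : Γ(dual L, U)) (a : Γ(symHom F L, U)) (z : C.presheaf.stalk x),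
    Projectivization.mk ℂ (value F hx s) hs = η ∧
    IsFrame (M := dual L) (fun _ : Fin 1 ↦ l) ∧
    (symHomι F L).app U a = squareSec l s ∧
    Irreducible z ∧
    r = (algebraMap (C.presheaf.stalk x) C.functionField z)⁻¹ • toRat _ hx a

lemma exists_isPsiSection (hL : IsVectorBundle L 1) {x : C} (hx : IsClosed ({x} : Set C))
    (η : ℙ ℂ (Fiber F x)) :
    ∃ (U : C.Opens) (hx : x ∈ U) (s : Γ(F, U)) (r : Rat (symHom F L)),
      IsPsiSection η U hx s r := by
  have := IsSmoothProjectiveCurve.isDVR _ hx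
  obtain ⟨z, hz⟩ := IsDiscreteValuationRing.exists_irreducible (C.presheaf.stalk x)
  induction η using Projectivization.ind with | h v hv => ?_
  obtain ⟨m, rfl⟩ := Submodule.Quotient.mk_surjective _ v
  obtain ⟨U, hU, s, rfl⟩ := TopCat.Presheaf.exists_germ_eq F.presheaf m
  have hs : value F hU s ≠ 0 := hv
  obtain ⟨V, hVU, hV, l, hl⟩ :=
    (hL.sheafHom (isVectorBundle_structureModule C)).exists_frame_le hU
  have hl' : IsFrame (M := dual L) fun _ : Fin 1 ↦ l 0 := by
    rwa [show (fun _ : Fin 1 ↦ l 0) = l from funext fun i ↦ by rw [Subsingleton.elim i 0]]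
  refine ⟨V, hV, res F hVU s, _, ?_, l 0, symSec (squareSec (l 0) (res F hVU s))
    (isSymm_of_rat hL.isTorsionFree hV _ (isSymmetricMap_squareSec hL hV _ hl' _)), z, ?_, hl',
    rfl, hz, rfl⟩
  · rwa [value_res F hVU hV]
  · simp only [value_res F hVU hV]
    rfl

lemma IsPsiSection.isPsi {x : C} {η : ℙ ℂ (Fiber F x)} {U : C.Opens} {hx : x ∈ U} {s : Γ(F, U)}
    {r : Rat (symHom F L)} (h : IsPsiSection η U hx s r)
    (h0 : H1.mk (symHom F L) (prinAt x r) ≠ 0) : IsPsi η (Projectivization.mk ℂ _ h0) := by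
  obtain ⟨hs, l, a, z, h1, h2, h3, h4, rfl⟩ := h
  exact ⟨U, hx, s, hs, l, a, z, h0, h1, h2, h3, h4, rfl⟩

lemma exists_isPsiSection_of_isPsi {x : C} {η : ℙ ℂ (Fiber F x)} {P : ℙ ℂ (H1 (symHom F L))}
    (h : IsPsi η P) : ∃ (U : C.Opens) (hx : x ∈ U) (s : Γ(F, U)) (r : Rat (symHom F L)),
      IsPsiSection η U hx s r ∧ ∃ h0 : H1.mk (symHom F L) (prinAt x r) ≠ 0,
        Projectivization.mk ℂ _ h0 = P := by
  obtain ⟨U, hx, s, hs, l, a, z, h0, h1, h2, h3, h4, h5⟩ := h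
  exact ⟨U, hx, s, _, ⟨hs, l, a, z, h1, h2, h3, h4, rfl⟩, h0, h5⟩

lemma IsPsiSection.exists_functional (hL : IsVectorBundle L 1) {x : C} {η : ℙ ℂ (Fiber F x)}
    {U : C.Opens} {hx : x ∈ U} {s : Γ(F, U)} {r : Rat (symHom F L)}
    (h : IsPsiSection η U hx s r) :
    ∃ (Λ : Rat L →ₗ[C.functionField] C.functionField) (V : C.Opens) (hV : x ∈ V)
      (l₀ : Fin 1 → Γ(L, V)) (g : (C.presheaf.stalk x)ˣ) (z : C.presheaf.stalk x), IsFrame l₀ ∧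
      Λ (toRat L hV (l₀ 0)) = algebraMap (C.presheaf.stalk x) C.functionField g ∧ Irreducible z ∧
      ∀ φ, symMap F L r φ = ((algebraMap (C.presheaf.stalk x) C.functionField z)⁻¹ *
        Λ (ratHom F L φ (toRat F hx s))) • toRat F hx s := by
  obtain ⟨hs, l, a, z, h1, h2, h3, h4, rfl⟩ := h
  obtain ⟨Λ, V, hV, l₀, g, hl₀, hg, hΛ⟩ := exists_squareSec_functional hL hx l h2 s
  refine ⟨Λ, V, hV, l₀, g, z, hl₀, hg, h4, fun φ ↦ ?_⟩
  rw [map_smul, LinearMap.smul_apply, symMap_apply, ratMapK_toRat, h3, hΛ, smul_smul]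

/-- The factor of `z` in `φ(s)` cancels the simple pole. -/
lemma IsPsiSection.apply_mem (hL : IsVectorBundle L 1) {x : C} (hc : IsClosed ({x} : Set C))
    {η : ℙ ℂ (Fiber F x)} {U : C.Opens} {hx : x ∈ U} {s : Γ(F, U)} {r : Rat (symHom F L)}
    (h : IsPsiSection η U hx s r) {φ : Rat (sheafHom F L)} (hφ : VanishesOn φ x (toRat F hx s)) :
    symMap F L r φ ∈ regularAt F x := by
  have := IsSmoothProjectiveCurve.isDVR _ hc
  obtain ⟨Λ, V, hV, l₀, g, z, hl₀, hg, hz, hΛ⟩ := h.exists_functional hL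
  obtain ⟨c, hcm, u, hu, hφu⟩ := hφ
  obtain ⟨d, rfl⟩ := hl₀.exists_of_regular hV hu
  rw [hz.maximalIdeal_eq, Ideal.mem_span_singleton] at hcm
  obtain ⟨c, rfl⟩ := hcm
  have hz0 : algebraMap (C.presheaf.stalk x) C.functionField z ≠ 0 := by
    simpa using hz.ne_zero
  rw [hΛ, hφu, Fin.sum_univ_one, map_smul, map_smul, hg, map_mul, smul_eq_mul, smul_eq_mul,
    mul_assoc, inv_mul_cancel_left₀ hz0, ← map_mul, ← map_mul]
  exact smul_mem_regularAt _ (toRat_mem_regularAt _ _ _)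

/-- A symmetric principal part at `x` that is regular on the sections with values in `Ker(η)` is a
multiple of the principal part `λ ⊗ s ⊗ s / z`. -/
lemma IsPsiSection.exists_sub_mem (hF : IsVectorBundle F n) (hL : IsVectorBundle L 1) {x : C}
    (hc : IsClosed ({x} : Set C)) {η : ℙ ℂ (Fiber F x)} {U : C.Opens} {hx : x ∈ U} {s : Γ(F, U)}
    {r : Rat (symHom F L)} (h : IsPsiSection η U hx s r) {q : Rat (symHom F L)}
    (hq : ∀ φ ∈ regularAt (sheafHom F L) x, VanishesOn φ x (toRat F hx s) →
      symMap F L q φ ∈ regularAt F x) :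
    ∃ c : ℂ, q - c • r ∈ regularAt (symHom F L) x := by
  have := IsSmoothProjectiveCurve.isDVR _ hc
  obtain ⟨Λ, V, hV, l₀, g, z, hl₀, hg, hz, hΛ⟩ := h.exists_functional hL
  -- A section transverse to `Ker(η)`. Modulo the sections vanishing on `s`, it generates the
  -- sections of `F* ⊗ L` regular at `x`.
  obtain ⟨φ₁, hφ₁, hφ₁s⟩ := exists_eq_of_value_ne_zero hF hx h.choose hV (l₀ 0)
  have hl : toRat L hV (l₀ 0) ∈ regularAt L x := toRat_mem_regularAt _ _ _
  have hzm : z ∈ IsLocalRing.maximalIdeal (C.presheaf.stalk x) := by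
    rw [hz.maximalIdeal_eq]; exact Ideal.mem_span_singleton_self z
  set ι := algebraMap (C.presheaf.stalk x) C.functionField with hι
  have hz0 : ι z ≠ 0 := by simpa [hι] using hz.ne_zero
  -- Since `z φ₁` vanishes on `s`, the only entry of `q` that matters, `φ₁(q φ₁)`, has at most a
  -- simple pole: it equals `(d / z) l₀`.
  have h1 : symMap F L q (ι z • φ₁) ∈ regularAt F x :=
    hq _ (smul_mem_regularAt z hφ₁) ⟨z, hzm, _, hl, by rw [map_smul, LinearMap.smul_apply, hφ₁s]⟩
  obtain ⟨d', hd⟩ := hl₀.exists_of_regular hV (ratHom_mem hφ₁ h1)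
  rw [Fin.sum_univ_one, map_smul, map_smul, ← hι] at hd
  generalize d' 0 = d at hd
  -- The corresponding entry of `r` is `(g / z) l₀`, so `c` must be the value of `d / g` at `x`, a
  -- complex number because the residue field is `ℂ`.
  obtain ⟨c, hcm⟩ := exists_const_sub_mem hc (d * (g⁻¹ : (C.presheaf.stalk x)ˣ))
  rw [hz.maximalIdeal_eq, Ideal.mem_span_singleton] at hcm
  obtain ⟨b, hb⟩ := hcm
  refine ⟨c, (symHom_regular_iff hF hL).2 ?_⟩
  set p := symMap F L (q - c • r) with hp
  have hps : IsSymmetricMap p := isSymmetricMap_ratMapK _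
  have hpe : ∀ φ, p φ = symMap F L q φ -
      (constStalk C (genericPoint C) c : C.functionField) • symMap F L r φ := fun φ ↦ by
    rw [hp, map_sub, csmul_eq, map_smul]
    rfl
  have hpv : ∀ φ ∈ regularAt (sheafHom F L) x, VanishesOn φ x (toRat F hx s) →
      p φ ∈ regularAt F x := fun φ hφ hv ↦ by
    rw [hpe]
    exact sub_mem (hq φ hφ hv) ((regularAt F x).smul_mem c (h.apply_mem hL hc hv))
  have h2 : ratHom F L φ₁ (p φ₁) = ι (b * g) • toRat L hV (l₀ 0) := by
    have h3 : ratHom F L φ₁ (symMap F L q φ₁) = ((ι z)⁻¹ * ι d) • toRat L hV (l₀ 0) := by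
      rw [mul_smul, ← hd, inv_smul_smul₀ hz0]
    have h4 : ι d = (constStalk C (genericPoint C) c + ι z * ι b) * ι g := by
      rw [← algebraMap_constStalk x c, ← hι, ← map_mul, ← map_add, ← hb, ← map_mul]
      congr 1
      rw [add_sub_cancel, mul_assoc, Units.inv_mul, mul_one]
    rw [hpe, map_sub, h3, map_smul, hΛ, map_smul, hφ₁s, hg, smul_smul, ← sub_smul, h4,
      map_mul]
    congr 1
    field_simp
    ring
  have hsplit : ∀ φ ∈ regularAt (sheafHom F L) x, ∃ e : C.presheaf.stalk x,
      φ - ι e • φ₁ ∈ regularAt (sheafHom F L) x ∧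
        VanishesOn (φ - ι e • φ₁) x (toRat F hx s) := fun φ hφ ↦ by
    obtain ⟨e, he⟩ := hl₀.exists_of_regular hV (ratHom_mem hφ (toRat_mem_regularAt F hx s))
    rw [Fin.sum_univ_one] at he
    refine ⟨e 0, sub_mem hφ (smul_mem_regularAt _ hφ₁), 0, zero_mem _, _, hl, ?_⟩
    rw [map_sub, map_smul, LinearMap.sub_apply, LinearMap.smul_apply, hφ₁s, he, ← hι, sub_self,
      map_zero, zero_smul]
  -- Regularity is tested against `φ = e φ₁ + φ'` with `φ'` vanishing on `s`. The first term is
  -- regular by the choice of `c`; in the second, symmetry replaces `φ'(p φ₁)` by `φ₁(p φ')`.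
  have h5 : p φ₁ ∈ regularAt F x := mem_regularAt_of_dual hF hL fun φ hφ ↦ by
    obtain ⟨e, he, hv⟩ := hsplit φ hφ
    have h6 : ratHom F L (φ - ι e • φ₁) (p φ₁) ∈ regularAt L x := by
      rw [hps]
      exact ratHom_mem hφ₁ (hpv _ he hv)
    have h7 : ratHom F L (ι e • φ₁) (p φ₁) ∈ regularAt L x := by
      rw [map_smul, LinearMap.smul_apply, h2]
      exact smul_mem_regularAt _ (smul_mem_regularAt _ hl)
    have h8 := add_mem h6 h7
    rwa [← LinearMap.add_apply, ← map_add, sub_add_cancel] at h8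
  intro φ hφ
  obtain ⟨e, he, hv⟩ := hsplit φ hφ
  have h9 := add_mem (hpv _ he hv) (smul_mem_regularAt e h5)
  rwa [← map_smul, ← map_add, sub_add_cancel] at h9

end

/-! ### Elementary transformations -/

section

variable {C : Scheme.{0}} [C.Over SpecC] [IsSmoothProjectiveCurve C] {F L E : C.Modules} {n t : ℕ}

/-- `γ` is injective with image the sections of `F* ⊗ L` that take values in `Ker(η k)` at `x k`
for all `k`. -/
structure IsElementaryTransformation (x : Fin t → C) (η : ∀ k, ℙ ℂ (Fiber F (x k)))
    (γ : E ⟶ sheafHom F L) : Prop where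
  isClosed : ∀ k, IsClosed {x k}
  injective : Function.Injective x
  mono : Mono γ
  exists_iff : ∀ (U : C.Opens) (φ : Γ(sheafHom F L, U)),
    (∃ e : Γ(E, U), γ.app U e = φ) ↔ ∀ k, TakesValuesInKer φ (η k)

omit [C.Over SpecC] [IsSmoothProjectiveCurve C] in
/-- A finite set of closed points has an open neighbourhood of any other point in its complement. -/
lemma exists_opens_notMem {t : ℕ} {x : Fin t → C} (hx : ∀ k, IsClosed {x k}) (y : C) :
    ∃ U : C.Opens, y ∈ U ∧ ∀ k, x k ∈ U → x k = y := by
  have hc : IsClosed (⋃ k ∈ {k : Fin t | x k ≠ y}, {x k}) :=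
    (Set.toFinite _).isClosed_biUnion fun k _ ↦ hx k
  refine ⟨⟨_, hc.isOpen_compl⟩, ?_, fun k hk ↦ ?_⟩
  · simp only [Set.mem_ofPred_eq, Opens.mem_mk, Set.mem_compl_iff, Set.mem_iUnion,
      Set.mem_singleton_iff, not_exists]
    exact fun k hk h ↦ hk h.symm
  · by_contra h
    refine hk (Set.mem_iUnion₂.2 ⟨k, h, rfl⟩)

namespace IsElementaryTransformation

variable {x : Fin t → C} {η : ∀ k, ℙ ℂ (Fiber F (x k))} {γ : E ⟶ sheafHom F L}
  (h : IsElementaryTransformation x η γ)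

include h

/-- On a small neighbourhood of `y` no other point `x k` remains, so only the conditions at `y`
itself have to be checked. -/
lemma exists_of_regular {y : C} {φ : Rat (sheafHom F L)} (hφ : φ ∈ regularAt (sheafHom F L) y)
    (H : ∀ (V : C.Opens) (hV : y ∈ V) (f : Γ(sheafHom F L, V)), toRat _ hV f = φ →
      ∀ k, x k = y → TakesValuesInKer f (η k)) :
    ∃ s ∈ regularAt E y, ratMapK γ s = φ := by
  obtain ⟨U, hy, hU⟩ := exists_opens_notMem h.isClosed y
  obtain ⟨V, hVU, hV, f, rfl⟩ := exists_toRat_of_regular hφ hy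
  obtain ⟨e, rfl⟩ := (h.exists_iff V f).2 fun k ↦ by
    by_cases hk : x k = y
    · exact H V hV f rfl k hk
    · exact fun T hT hxT ↦ (hk (hU k (hVU (hT hxT)))).elim
  exact ⟨_, toRat_mem_regularAt E hV e, ratMapK_toRat γ hV e⟩

/-- The generic point is not closed, so no condition is imposed there. -/
lemma bijective : Function.Bijective (ratMapK γ) := by
  have := h.mono
  constructor
  · rw [injective_iff_map_eq_zero]
    intro r hr
    obtain ⟨U, hU, e, rfl⟩ := exists_toRat _ r
    rw [ratMapK_toRat, ← toRat_zero _ hU] at hr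
    obtain ⟨T, hT, _, hgT, he⟩ := toRat_eq_iff _ _ _ _ _ hr
    rw [← app_res, map_zero] at he
    rw [← toRat_res _ hT hU hgT, app_injective_of_mono γ T (he.trans (map_zero _).symm),
      toRat_zero]
  · intro φ
    obtain ⟨s, -, hs⟩ := h.exists_of_regular (mem_regularAt_genericPoint _ φ) fun V hV f hf k hk ↦
      (genericPoint_not_isClosed (hk ▸ h.isClosed k)).elim
    exact ⟨s, hs⟩

/-- Membership in `E` is a condition on all local sections with value in `η k`. Such a section is a
constant multiple of `s` plus a section with value zero, so testing on `s` suffices. -/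
lemma exists_of_vanishesOn (hF : IsVectorBundle F n) (hL : IsVectorBundle L 1) (k : Fin t)
    {U : C.Opens} {hx : x k ∈ U} {s : Γ(F, U)} (hs : value F hx s ≠ 0)
    (hη : Projectivization.mk ℂ (value F hx s) hs = η k) {φ : Rat (sheafHom F L)}
    (hφ : φ ∈ regularAt (sheafHom F L) (x k)) (hv : VanishesOn φ (x k) (toRat F hx s)) :
    ∃ s ∈ regularAt E (x k), ratMapK γ s = φ := by
  refine h.exists_of_regular hφ fun V hV f hf j hj ↦ ?_
  obtain rfl := h.injective hj
  intro T hT hxT s' hs'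
  rw [← hη, Projectivization.submodule_mk, Submodule.mem_span_singleton] at hs'
  obtain ⟨c, hc⟩ := hs'
  let A := T ⊓ U
  have hxA : x j ∈ A := ⟨hxT, hx⟩
  let a : Γ(C, A) := resO C le_top (constO C c)
  have ha : C.presheaf.germ A (x j) hxA a = constStalk C (x j) c := germ_resO _ _ _
  have hc' : value F hxA (res F inf_le_left s') = value F hxA (a • res F inf_le_right s) := by
    rw [value_smul, value_res F _ hxA, value_res F _ hxA, ha, ← hc]
    rfl
  let φ' : HomSec F L A := HomSec.restrict (inf_le_left.trans hT) f
  have h1 : value L hxA (φ'.app A le_rfl (res F inf_le_left s' - a • res F inf_le_right s)) = 0 := by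
    refine value_apply_eq_zero hF hxA φ' ?_
    rw [sub_eq_add_neg, ← neg_one_smul Γ(C, A) (a • _), value_add, value_smul, hc', map_neg,
      map_one, neg_one_smul, add_neg_cancel]
  have h2 : value L hxA (φ'.app A le_rfl (res F inf_le_right s)) = 0 := by
    obtain ⟨b, hb, u, ⟨B, hB, u, rfl⟩, hbu⟩ := hv
    refine value_eq_zero_of_mem hL.isTorsionFree hB hxA hb (l := u) ?_
    rw [← hbu, ← hf, ← toRat_res F inf_le_right hx hxA]
    exact (ratHom_toRat hV hxA (inf_le_left.trans hT) f _).symm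
  have h3 : value L hxA (φ'.app A le_rfl (res F inf_le_left s')) = 0 := by
    have : res F inf_le_left s' = (res F inf_le_left s' - a • res F (inf_le_right : A ≤ U) s) +
        a • res F inf_le_right s := by abel
    rw [this, map_add, map_smul, value_add, value_smul, h1, h2, smul_zero, add_zero]
  rw [← value_res L (inf_le_left : A ≤ T) hxA]
  refine Eq.trans ?_ h3
  congr 1
  exact (HomSec.app_res (HomSec.restrict hT f) T A le_rfl inf_le_left s').symm

lemma vanishesOn (hL : IsVectorBundle L 1) (k : Fin t)
    {U : C.Opens} {hx : x k ∈ U} {s : Γ(F, U)} (hs : value F hx s ≠ 0)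
    (hη : Projectivization.mk ℂ (value F hx s) hs = η k) {e : Rat E}
    (he : e ∈ regularAt E (x k)) : VanishesOn (ratMapK γ e) (x k) (toRat F hx s) := by
  obtain ⟨V, hVU, hV, e, rfl⟩ := exists_toRat_of_regular he hx
  obtain ⟨T, hT, l, hl⟩ := hL (x k)
  have h1 := (h.exists_iff V (γ.app V e)).1 ⟨e, rfl⟩ k V le_rfl hV (res F hVU s) (by
    rw [value_res F hVU hV, ← hη, Projectivization.submodule_mk]
    exact Submodule.mem_span_singleton_self _)
  obtain ⟨c, hc, h2⟩ := exists_of_value_eq_zero hl hT hV h1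
  refine ⟨c, hc, _, toRat_mem_regularAt L hT (l 0), ?_⟩
  rw [← h2, ratMapK_toRat, ← toRat_res F hVU hx hV, ratHom_toRat hV hV le_rfl, res_self]
  rfl

end IsElementaryTransformation

end

/-! ### The span of the points `ψ(η)` -/

section

variable {C : Scheme.{0}} [C.Over SpecC] [IsSmoothProjectiveCurve C] {F L E : C.Modules} {n t : ℕ}
  {x : Fin t → C} {η : ∀ k, ℙ ℂ (Fiber F (x k))} {γ : E ⟶ sheafHom F L}

lemma prinAt_apply_self {M : C.Modules} (y : C) (r : Rat M) : (prinAt y r).1 y = r := by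
  classical exact Pi.single_eq_same (M := fun _ ↦ Rat M) y r

lemma prinAt_apply_ne {M : C.Modules} {y z : C} (h : z ≠ y) (r : Rat M) : (prinAt y r).1 z = 0 := by
  classical exact Pi.single_eq_of_ne (M := fun _ ↦ Rat M) h r

lemma IsElementaryTransformation.prinAt_mem_regularOn (h : IsElementaryTransformation x η γ)
    (hL : IsVectorBundle L 1) (k : Fin t) {U : C.Opens} {hx : x k ∈ U} {s : Γ(F, U)}
    {r : Rat (symHom F L)} (hr : IsPsiSection (η k) U hx s r) :
    prinAt (x k) r ∈ regularOn E γ := by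
  intro y e he
  by_cases hy : y = x k
  · subst hy
    obtain ⟨hs, -, -, -, hη, -⟩ := id hr
    rw [prinAt_apply_self]
    exact hr.apply_mem hL (h.isClosed k) (h.vanishesOn hL k hs hη he)
  · rw [prinAt_apply_ne hy, map_zero]
    exact zero_mem _

/-- Modulo regular parts, a principal part regular on `E` is supported at the points `x k`, where
the local computation makes it a multiple of `λ ⊗ s ⊗ s / z`. -/
lemma IsElementaryTransformation.submodule_span_eq (h : IsElementaryTransformation x η γ)
    (hF : IsVectorBundle F n) (hL : IsVectorBundle L 1) :
    Projectivization.Subspace.submodule (Projectivization.Subspace.span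
      {P : ℙ ℂ (H1 (symHom F L)) | ∃ k, IsPsi (η k) P}) =
        (regularOn E γ).map (H1.mk (symHom F L)) := by
  apply le_antisymm
  · rw [← OrderIso.le_symm_apply]
    change _ ≤ Submodule.projectivization _
    rw [Projectivization.Subspace.span_le_subspace_iff]
    -- Every choice of `s`, `λ` and `z` gives a principal part regular on `E`, so independence of
    -- `ψ(η)` of these choices is not needed.
    rintro P ⟨k, hP⟩
    obtain ⟨U, hx, s, r, hr, h0, rfl⟩ := exists_isPsiSection_of_isPsi hP
    refine (Submodule.mem_projectivization_iff_submodule_le _ _).2 ?_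
    rw [Projectivization.submodule_mk, Submodule.span_singleton_le_iff_mem]
    exact Submodule.mem_map_of_mem (h.prinAt_mem_regularOn hL k hr)
  · rintro _ ⟨P, hP, rfl⟩
    choose U hU s r hr using fun k ↦ exists_isPsiSection hL (h.isClosed k) (η k)
    have key : ∀ k, ∃ c : ℂ, P.1 (x k) - c • r k ∈ regularAt (symHom F L) (x k) := fun k ↦ by
      refine (hr k).exists_sub_mem hF hL (h.isClosed k) fun φ hφ hv ↦ ?_
      obtain ⟨hs, -, -, -, hη, -⟩ := id (hr k)
      obtain ⟨e, he, rfl⟩ := h.exists_of_vanishesOn hF hL k hs hη hφ hv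
      exact hP _ e he
    choose c hc using key
    have hsum : H1.mk _ P = ∑ k, c k • H1.mk (symHom F L) (prinAt (x k) (r k)) := by
      rw [← Finset.sum_congr rfl fun k _ ↦ map_smul (H1.mk (symHom F L)) (c k) _, ← map_sum]
      refine H1.mk_eq_iff.2 ⟨0, fun y ↦ ?_⟩
      have h1 : (∑ k, c k • prinAt (x k) (r k) : PrinRep (symHom F L)).1 y =
          ∑ k, c k • (prinAt (x k) (r k)).1 y := by
        simp
      rw [h1, sub_zero]
      by_cases hy : ∃ k, x k = y
      · obtain ⟨k, rfl⟩ := hy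
        rw [Finset.sum_eq_single k, prinAt_apply_self]
        · exact hc k
        -- The points are distinct, so only one summand has a pole at `x k`.
        · intro j _ hjk
          rw [prinAt_apply_ne (fun e ↦ hjk (h.injective e.symm)), smul_zero]
        · simp
      · push Not at hy
        rw [Finset.sum_eq_zero fun k _ ↦ by rw [prinAt_apply_ne (hy k).symm, smul_zero], sub_zero,
          symHom_regular_iff hF hL]
        intro φ hφ
        -- Away from the points `x k` all regular sections of `F* ⊗ L` come from `E`, so `P` is
        -- regular.
        obtain ⟨e, he, rfl⟩ := h.exists_of_regular hφ fun V hV f hf k hk ↦ (hy k hk).elim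
        exact hP _ e he
    rw [hsum]
    refine sum_mem fun k _ ↦ Submodule.smul_mem _ _ ?_
    -- Where `ψ` is undefined the class is zero and contributes nothing to the sum.
    by_cases h0 : H1.mk (symHom F L) (prinAt (x k) (r k)) = 0
    · rw [h0]
      exact zero_mem _
    · rw [Projectivization.Subspace.mem_submodule_iff _ h0]
      exact Projectivization.Subspace.subset_span _ ⟨k, (hr k).isPsi h0⟩

end

end LagLift

end

/-! ### The lifting criterion. -/

theorem mainTheorem8
    (C : AlgebraicGeometry.Scheme.{0}) [C.Over LagLift.SpecC] [LagLift.IsSmoothProjectiveCurve C]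
    (n : ℕ) (F L W : C.Modules)
    (hF : LagLift.IsVectorBundle F n) (hL : LagLift.IsVectorBundle L 1)
    (hW : LagLift.IsVectorBundle W (2 * n))
    (ω : W ⟶ LagLift.sheafHom W L) (hω : LagLift.IsSymplectic ω)
    (i : F ⟶ W) (hi : LagLift.IsSubbundle i) (hi' : LagLift.IsIsotropic ω i)
    (t : ℕ) (x : Fin t → C) (hx : ∀ k, IsClosed {x k}) (hx' : Function.Injective x)
    (η : ∀ k, ℙ ℂ (LagLift.Fiber F (x k)))
    (E : C.Modules) (γ : E ⟶ LagLift.sheafHom F L) (hγ : Mono γ)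
    (hE : ∀ (U : C.Opens) (φ : Γ(LagLift.sheafHom F L, U)),
      (∃ e : Γ(E, U), γ.app U e = φ) ↔ ∀ k, LagLift.TakesValuesInKer φ (η k)) :
    ∃ δ : LagLift.H1 (LagLift.symHom F L),
      (∀ δ' : LagLift.H1 (LagLift.symHom F L),
        LagLift.IsExtensionClass i (LagLift.quotMap ω i)
          (LagLift.H1.map (LagLift.symHomι F L) δ') ↔ δ' = δ) ∧
      ((∃ j : E ⟶ W, j ≫ LagLift.quotMap ω i = γ ∧ LagLift.IsLagrangianSubsheaf n ω j) ↔
        δ ∈ Projectivization.Subspace.submodule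
          (Projectivization.Subspace.span
            {P : ℙ ℂ (LagLift.H1 (LagLift.symHom F L)) | ∃ k, LagLift.IsPsi (η k) P})) := by
  have h : LagLift.IsLagrangianSubbundle n ω i := ⟨hF, hL, hW, hω, hi, hi'⟩
  have hγE : LagLift.IsElementaryTransformation x η γ := ⟨hx, hx', hγ, hE⟩
  obtain ⟨σ, P, hσ, hP⟩ := h.exists_class
  refine ⟨LagLift.H1.mk _ P, fun δ' ↦ ?_, ?_⟩
  · obtain ⟨P', rfl⟩ := LagLift.H1.mk_surjective _ δ'
    rw [LagLift.isExtensionClass_map_mk_iff h]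
    constructor
    · rintro ⟨σ', hσ', hP'⟩
      exact h.mk_eq hσ' hP' hσ.split hP
    · intro hδ
      rw [← LagLift.isExtensionClass_map_mk_iff h, hδ, LagLift.isExtensionClass_map_mk_iff h]
      exact ⟨σ, hσ.split, hP⟩
  · rw [LagLift.exists_lagrangianSubsheaf_iff h hγE.bijective hσ hP,
      hγE.submodule_span_eq hF hL]
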